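/- Let $A$ be a set of actions with a distinguished termination action $\surd\in A$, let $\lambda\in(0,1]$, and let $T$ be the set of closed terms (processes) built from the constants $0$ and $\varepsilon$, the probabilistic prefixes $a.([p_1]\_\oplus\dots\oplus[p_m]\_)$ ($a\in A$, $m\ge 1$, $p_k\in(0,1]$, $\sum_k p_k=1$) and the binary operators $;$ (sequential composition), $+$, $+_p$ (nondeterministic and probabilistic alternative composition), $\mid$ (synchronous parallel composition), $|||$, $|||_p$ (nondeterministic and probabilistic interleaving), with $p\in(0,1)$, and $\parallel_B$ with $B\subseteq A$ (CSP parallel composition). Write $t\xrightarrow{a}\pi$, with $\pi$ a probability distribution on $T$, for the transitions derived from the following rules, where $\delta(t)$ is the Dirac distribution, $\mu\oplus_p\nu=p\mu+(1-p)\nu$, and operators are applied to distributions via the product distribution. * $\varepsilon\xrightarrow{\surd}\delta(0)$; $\;a.([p_1]t_1\oplus\dots\oplus[p_m]t_m)\xrightarrow{a}\sum_k p_k\delta(t_k)$; $0$ has no transition. * $x;y\xrightarrow{a}\mu;\delta(y)$ if $x\xrightarrow{a}\mu$, $a\ne\surd$; $\;x;y\xrightarrow{a}\nu$ if $x$ has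 a $\surd$-transition and $y\xrightarrow{a}\nu$. * $x+y\xrightarrow{a}\mu$ if $x\xrightarrow{a}\mu$ or $y\xrightarrow{a}\mu$. * $x+_py\xrightarrow{a}\mu\oplus_p\nu$ if $x\xrightarrow{a}\mu$ and $y\xrightarrow{a}\nu$; if only one of $x,y$ has an $a$-transition, then $x+_py$ has its $a$-transitions. * For $f$ any of $\mid,|||,|||_p,\parallel_B$: $x\,f\,y\xrightarrow{\surd}\delta(0)$ if both $x$ and $y$ have a $\surd$-transition, and no other $\surd$-transition exists. For $a\neq\surd$: $\mid$ has the transitions $x\mid y\xrightarrow{a}\mu\mid\nu$ with $x\xrightarrow{a}\mu$, $y\xrightarrow{a}\nu$; $|||$ has the transitions $x\,|||\,y\xrightarrow{a}\mu\,|||\,\delta(y)$ with $x\xrightarrow{a}\mu$ and $x\,|||\,y\xrightarrow{a}\delta(x)\,|||\,\nu$ with $y\xrightarrow{a}\nu$; $\parallel_B$ behaves like $\mid$ for $a\in B$ and like $|||$ for $a\notin B$; $x\,|||_p\,y\xrightarrow{a}(\mu\,|||_p\,\delta(y))\oplus_p(\delta(x)\,|||_p\,\nu)$ if $x\xrightarrow{a}\mu$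 and $y\xrightarrow{a}\nu$, and if only one of $x,y$ has an $a$-transition, then $|||_p$ behaves like $|||$. Let $\mathbf d$ be the $\lambda$-bisimilarity metric on $T$, i.e. the smallest pseudometric $d\colon T\times T\to[0,1]$ such that whenever $d(t,t')<1$ and $t\xrightarrow{a}\pi$ there is $t'\xrightarrow{a}\pi'$ with $\lambda\,\mathbf K(d)(\pi,\pi')\le d(t,t')$, where $\mathbf K(d)$ is the Kantorovich lifting of $d$ (minimal expected $d$-distance over all couplings). A binary operator $f$ is non-extensive if $\mathbf d(f(s_1,s_2),f(t_1,t_2))\le\max(\mathbf d(s_1,t_1),\mathbf d(s_2,t_2))$ for all processes. Let $N\ge2$ and suppose that $A$ contains at least $N+2$ actions other than $\surd$. Then for all $\epsilon_1,\dots,\epsilon_N\in[0,\lambda]\cup\{1\}$ (so for all $\epsilon_i\in[0,1]$ if $\lambda=1$) and every $B\subseteq A$ there are processes $s_i,t_i\in T$ with $\mathbf d(s_i,t_i)=\epsilon_i$ ($1\le i\le N$) such that, with $$d^n_{i,j}=\epsilon_i+\lambda^n(1-\epsilon_i/\lambda)\epsilon_j,\quad d^s=\begin{cases}1&\text{if }\epsilon_1=1\text{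 or }\epsilon_2=1\\ d^0_{1,2}&\text{otherwise,}\end{cases}\quad d^a=\begin{cases}1&\text{if }\epsilon_1=1\text{ or }\epsilon_2=1\\ \max(d^2_{1,2},d^2_{2,1})&\text{otherwise,}\end{cases}$$ all of the following hold simultaneously: 1. $\mathbf d(a.\bigoplus_{k=1}^m[p_k]s_{i_k},\,a.\bigoplus_{k=1}^m[p_k]t_{i_k})=\lambda\sum_{k=1}^m p_k\epsilon_{i_k}$ for every $a\in A$, all weights $p_1,\dots,p_m\in(0,1]$ of sum $1$ and all indices $i_1,\dots,i_m\in\{1,\dots,N\}$; 2. $\mathbf d(s_1+s_2,t_1+t_2)=\max(\epsilon_1,\epsilon_2)$, and $\mathbf d(s_1+_ps_2,t_1+_pt_2)=\max(\epsilon_1,\epsilon_2)$ for every $p\in(0,1)$; 3. $\mathbf d(s_1;s_2,t_1;t_2)$ is $1$ if $\epsilon_1=1$, and $\max(d^1_{1,2},\epsilon_2)$ otherwise; 4. $\mathbf d(s_1\mid s_2,t_1\mid t_2)=d^s$; 5. $\mathbf d(s_1\,|||\,s_2,t_1\,|||\,t_2)=d^a$, and $\mathbf d(s_1\,|||_p\,s_2,t_1\,|||_p\,t_2)=d^a$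 for every $p\in(0,1)$; 6. $\mathbf d(s_1\parallel_Bs_2,t_1\parallel_Bt_2)$ is $d^s$ if $B\setminus\{\surd\}\ne\emptyset$, and $d^a$ otherwise. Moreover, none of $;$, $\mid$, $|||$, $\parallel_B$ ($B\subseteq A$), $|||_p$ ($p\in(0,1)$) is non-extensive with respect to $\mathbf d$. -/

import Mathlib

open scoped ENNReal

noncomputable section

/-! ### Probability distributions -/

/-- The convex combination `μ ⊕_p ν`, i.e. `p μ + (1 - p) ν`. -/
def convexComb {S : Type*} (p : Set.Ioo (0 : ℝ) 1) (μ ν : PMF S) : PMF S :=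
  ⟨fun x => ENNReal.ofReal p * μ x + ENNReal.ofReal (1 - p) * ν x, by
    have h : ENNReal.ofReal p * 1 + ENNReal.ofReal (1 - p) * 1 = 1 := by
      rw [mul_one, mul_one, ← ENNReal.ofReal_add p.2.1.le (by linarith [p.2.2])]
      simp
    have h1 : HasSum (fun x => ENNReal.ofReal p * μ x + ENNReal.ofReal (1 - p) * ν x)
        (∑' x, (ENNReal.ofReal p * μ x + ENNReal.ofReal (1 - p) * ν x)) :=
      ENNReal.summable.hasSum
    rwa [ENNReal.tsum_add, ENNReal.tsum_mul_left, ENNReal.tsum_mul_left, PMF.tsum_coe,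
      PMF.tsum_coe, h] at h1⟩

/-- The product distribution `f(μ, ν)` for a binary operator `f`: the distribution of `f x y`
for independent `x` and `y` distributed according to `μ` and `ν`. -/
def liftOp {S : Type*} (f : S → S → S) (μ ν : PMF S) : PMF S :=
  μ.bind fun x => ν.map fun y => f x y

/-- Weights `p₁, …, pₙ > 0` with `p₁ + ⋯ + pₙ = 1` (so `n ≥ 1` and every `pᵢ` is in `(0, 1]`). -/
structure Weights (n : ℕ) where
  w : Fin n → ℝ
  pos : ∀ i, 0 < w i
  sum_eq_one : ∑ i, w i = 1

/-- The distribution on indices that gives `i` the probability `pᵢ`. -/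
def Weights.toPMF {n : ℕ} (p : Weights n) : PMF (Fin n) :=
  PMF.ofFintype (fun i => ENNReal.ofReal (p.w i)) (by
    rw [← ENNReal.ofReal_sum_of_nonneg fun i _ => (p.pos i).le, p.sum_eq_one,
      ENNReal.ofReal_one])

/-! ### Bisimilarity metric of a probabilistic transition system -/

/-- A `1`-bounded pseudometric on `S`. -/
structure IsBoundedPseudometric {S : Type*} (d : S → S → ℝ) : Prop where
  nonneg : ∀ x y, 0 ≤ d x y
  le_one : ∀ x y, d x y ≤ 1
  self : ∀ x, d x x = 0
  symm : ∀ x y, d x y = d y x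
  triangle : ∀ x y z, d x z ≤ d x y + d y z

/-- The matchings of two distributions: the distributions on the product with the given
marginals. -/
def matchings {S : Type*} (π π' : PMF S) : Set (PMF (S × S)) :=
  {ω | ω.map Prod.fst = π ∧ ω.map Prod.snd = π'}

/-- The Kantorovich lifting of `d`. -/
def kantorovich {S : Type*} (d : S → S → ℝ) (π π' : PMF S) : ℝ :=
  sInf ((fun ω : PMF (S × S) => ∑' x : S × S, d x.1 x.2 * (ω x).toReal) '' matchings π π')

/-- `d` is a `lam`-bisimulation metric for the probabilistic transition system with transition
relation `tr`. -/
structure IsBisimMetric {S A : Type*} (tr : S → A → PMF S → Prop) (lam : ℝ)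
    (d : S → S → ℝ) : Prop where
  isBoundedPseudometric : IsBoundedPseudometric d
  transfer : ∀ s t, d s t < 1 → ∀ a π, tr s a π →
    ∃ π', tr t a π' ∧ lam * kantorovich d π π' ≤ d s t

/-- The `lam`-bisimilarity metric: the smallest `lam`-bisimulation metric, i.e. the pointwise
infimum of all of them. -/
def bisimDist {S A : Type*} (tr : S → A → PMF S → Prop) (lam : ℝ) (s t : S) : ℝ :=
  sInf {r | ∃ d, IsBisimMetric tr lam d ∧ r = d s t}

/-! ### The process algebra -/

/-- Closed terms of the process algebra over the action set `A`. -/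
inductive Proc (A : Type*) where
  /-- the inactive process `0` -/
  | nil : Proc A
  /-- the skip process `ε` -/
  | skip : Proc A
  /-- the probabilistic prefix `a.([p₁]t₁ ⊕ ⋯ ⊕ [pₙ]tₙ)` -/
  | pre (a : A) {n : ℕ} (p : Weights n) (t : Fin n → Proc A) : Proc A
  /-- sequential composition `s ; t` -/
  | seq (s t : Proc A) : Proc A
  /-- alternative composition `s + t` -/
  | alt (s t : Proc A) : Proc A
  /-- probabilistic alternative composition `s +_p t` -/
  | palt (p : Set.Ioo (0 : ℝ) 1) (s t : Proc A) : Proc A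
  /-- synchronous parallel composition `s | t` -/
  | sync (s t : Proc A) : Proc A
  /-- asynchronous parallel composition `s ||| t` -/
  | async (s t : Proc A) : Proc A
  /-- probabilistic parallel composition `s |||_p t` -/
  | pasync (p : Set.Ioo (0 : ℝ) 1) (s t : Proc A) : Proc A
  /-- CSP-like parallel composition `s ∥_B t` -/
  | csp (B : Set A) (s t : Proc A) : Proc A

/-- The transition relation: `Step tick t a π` means `t —a→ π`, where `tick` is the successful
termination action. Each disjunct is one SOS rule; since premises only concern the arguments of
the source, the transitions are determined by recursion on the source term. -/
def Step {A : Type*} (tick : A) : Proc A → A → PMF (Proc A) → Prop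
  | .nil, _, _ => False
  | .skip, a, π => a = tick ∧ π = PMF.pure .nil
  | .pre b p t, a, π => a = b ∧ π = p.toPMF.map t
  | .seq x y, a, π =>
      (a ≠ tick ∧ ∃ μ, Step tick x a μ ∧ π = liftOp .seq μ (PMF.pure y)) ∨
      ((∃ μ, Step tick x tick μ) ∧ Step tick y a π)
  | .alt x y, a, π => Step tick x a π ∨ Step tick y a π
  | .palt p x y, a, π =>
      (Step tick x a π ∧ ¬ ∃ ν, Step tick y a ν) ∨
      ((¬ ∃ μ, Step tick x a μ) ∧ Step tick y a π) ∨
      (∃ μ ν, Step tick x a μ ∧ Step tick y a ν ∧ π = convexComb p μ ν)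
  | .sync x y, a, π =>
      (a ≠ tick ∧ ∃ μ ν, Step tick x a μ ∧ Step tick y a ν ∧ π = liftOp .sync μ ν) ∨
      (a = tick ∧ (∃ μ, Step tick x tick μ) ∧ (∃ ν, Step tick y tick ν) ∧
        π = PMF.pure .nil)
  | .async x y, a, π =>
      (a ≠ tick ∧ ∃ μ, Step tick x a μ ∧ π = liftOp .async μ (PMF.pure y)) ∨
      (a ≠ tick ∧ ∃ ν, Step tick y a ν ∧ π = liftOp .async (PMF.pure x) ν) ∨
      (a = tick ∧ (∃ μ, Step tick x tick μ) ∧ (∃ ν, Step tick y tick ν) ∧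
        π = PMF.pure .nil)
  | .pasync p x y, a, π =>
      (a ≠ tick ∧ (¬ ∃ ν, Step tick y a ν) ∧
        ∃ μ, Step tick x a μ ∧ π = liftOp (.pasync p) μ (PMF.pure y)) ∨
      (a ≠ tick ∧ (¬ ∃ μ, Step tick x a μ) ∧
        ∃ ν, Step tick y a ν ∧ π = liftOp (.pasync p) (PMF.pure x) ν) ∨
      (a ≠ tick ∧ ∃ μ ν, Step tick x a μ ∧ Step tick y a ν ∧
        π = convexComb p (liftOp (.pasync p) μ (PMF.pure y))
          (liftOp (.pasync p) (PMF.pure x) ν)) ∨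
      (a = tick ∧ (∃ μ, Step tick x tick μ) ∧ (∃ ν, Step tick y tick ν) ∧
        π = PMF.pure .nil)
  | .csp B x y, a, π =>
      (a ∈ B \ {tick} ∧ ∃ μ ν, Step tick x a μ ∧ Step tick y a ν ∧
        π = liftOp (.csp B) μ ν) ∨
      (a = tick ∧ (∃ μ, Step tick x tick μ) ∧ (∃ ν, Step tick y tick ν) ∧
        π = PMF.pure .nil) ∨
      (a ∉ B ∪ {tick} ∧ ∃ μ, Step tick x a μ ∧ π = liftOp (.csp B) μ (PMF.pure y)) ∨
      (a ∉ B ∪ {tick} ∧ ∃ ν, Step tick y a ν ∧ π = liftOp (.csp B) (PMF.pure x) ν)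

/-- The `lam`-bisimilarity metric on processes. -/
def procDist {A : Type*} (tick : A) (lam : ℝ) (s t : Proc A) : ℝ :=
  bisimDist (Step tick) lam s t

/-- A binary process combinator is non-extensive if the distance of composed processes is at most
the maximum of the distances of the components. -/
def NonExtensive {A : Type*} (tick : A) (lam : ℝ) (f : Proc A → Proc A → Proc A) : Prop :=
  ∀ s₁ s₂ t₁ t₂ : Proc A, procDist tick lam (f s₁ s₂) (f t₁ t₂) ≤
    max (procDist tick lam s₁ t₁) (procDist tick lam s₂ t₂)

/-! ### The distance bounds, as functions of `e₁ = d(s₁, t₁)` and `e₂ = d(s₂, t₂)` -/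

/-- `dⁿ(e₁, e₂) = e₁ + lamⁿ (1 - e₁ / lam) e₂`. -/
def delayBound (lam : ℝ) (n : ℕ) (e₁ e₂ : ℝ) : ℝ :=
  e₁ + lam ^ n * (1 - e₁ / lam) * e₂

/-- The bound for sequential composition. -/
def seqBound (lam e₁ e₂ : ℝ) : ℝ :=
  if e₁ = 1 then 1 else max (delayBound lam 1 e₁ e₂) e₂

/-- The bound `d^s` for synchronous evolution. -/
def syncBound (lam e₁ e₂ : ℝ) : ℝ :=
  if e₁ = 1 ∨ e₂ = 1 then 1 else delayBound lam 0 e₁ e₂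

/-- The bound `d^a` for asynchronous evolution. -/
def asyncBound (lam e₁ e₂ : ℝ) : ℝ :=
  if e₁ = 1 ∨ e₂ = 1 then 1 else max (delayBound lam 2 e₁ e₂) (delayBound lam 2 e₂ e₁)

open Classical in
/-- The bound for the CSP-like parallel composition `∥_B`. -/
def cspBound {A : Type*} (tick : A) (B : Set A) (lam e₁ e₂ : ℝ) : ℝ :=
  if (B \ {tick}).Nonempty then syncBound lam e₁ e₂ else asyncBound lam e₁ e₂

end

/-!
The bisimilarity metric is a Knaster–Tarski least fixed point: when every process has finitely many
transitions for each action, the bounded pseudometrics that are prefixed points of the one-step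
functional `stepDist` are exactly the bisimulation metrics. So an upper bound on a distance follows
by matching the transitions of the two processes in both directions, and a lower bound by following
a single transition of one of them.

A distance `ε ≤ λ` is realised by a source whose first step deadlocks with probability `ε / λ`,
against a target that never deadlocks in its first step; after that step a live process can always
be told apart from a deadlocked one. Composing two such pairs, the binary operators differ in when
the two failures become visible. If both components move together, the second failure counts
whenever the first does not happen, which gives `ε₁ + (1 - ε₁ / λ) ε₂`. Sequential and interleaved
components let the second failure happen only one or two steps later, because the first component
has to pass its own first step (and, in an interleaving, an observable gate) before, which costs a
factor `λ` or `λ²`. Private labels of the two components determine which of them moves, so that the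
other process cannot answer with a different interleaving. A distance of `1` is realised by a
process that can perform an action which its target does not enable initially. Finally,
`ε₁ = ε₂ = λ / 2` makes all these bounds larger than `λ / 2`, which contradicts
non-extensiveness.
-/

noncomputable section

/-- The expectation `∑ x, g x μ(x)` of a real-valued function under a discrete distribution. It is
the quantity minimised by `kantorovich`; the series converges for bounded `g`. -/
def mean {α : Type*} (μ : PMF α) (g : α → ℝ) : ℝ := ∑' x, g x * (μ x).toReal

section Mean

variable {α β : Type*}

theorem summable_toReal (μ : PMF α) : Summable fun x => (μ x).toReal :=
  ENNReal.summable_toReal μ.tsum_coe_ne_top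

theorem tsum_toReal (μ : PMF α) : ∑' x, (μ x).toReal = 1 := by
  rw [← ENNReal.tsum_toReal_eq μ.apply_ne_top, μ.tsum_coe, ENNReal.toReal_one]

theorem summable_mul_toReal (μ : PMF α) {g : α → ℝ} (hg : ∀ x, g x ∈ Set.Icc (0 : ℝ) 1) :
    Summable fun x => g x * (μ x).toReal :=
  (summable_toReal μ).of_nonneg_of_le (fun x => mul_nonneg (hg x).1 ENNReal.toReal_nonneg)
    fun x => mul_le_of_le_one_left ENNReal.toReal_nonneg (hg x).2

theorem mean_eq_toReal (μ : PMF α) {g : α → ℝ} (h0 : ∀ x, 0 ≤ g x) :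
    mean μ g = (∑' x, ENNReal.ofReal (g x) * μ x).toReal := by
  rw [ENNReal.tsum_toReal_eq fun x => ENNReal.mul_ne_top ENNReal.ofReal_ne_top (μ.apply_ne_top x)]
  simp only [mean, ENNReal.toReal_mul, ENNReal.toReal_ofReal (h0 _)]

theorem tsum_ofReal_mul_le_one (μ : PMF α) {g : α → ℝ} (hg : ∀ x, g x ≤ 1) :
    ∑' x, ENNReal.ofReal (g x) * μ x ≤ 1 := by
  rw [← μ.tsum_coe]
  exact ENNReal.tsum_le_tsum fun x =>
    mul_le_of_le_one_left zero_le (ENNReal.ofReal_le_one.2 (hg x))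

theorem ofReal_mean (μ : PMF α) {g : α → ℝ} (hg : ∀ x, g x ∈ Set.Icc (0 : ℝ) 1) :
    ENNReal.ofReal (mean μ g) = ∑' x, ENNReal.ofReal (g x) * μ x := by
  rw [mean_eq_toReal μ fun x => (hg x).1, ENNReal.ofReal_toReal]
  exact ne_top_of_le_ne_top ENNReal.one_ne_top (tsum_ofReal_mul_le_one μ fun x => (hg x).2)

theorem mean_mem_Icc (μ : PMF α) {g : α → ℝ} (hg : ∀ x, g x ∈ Set.Icc (0 : ℝ) 1) :
    mean μ g ∈ Set.Icc (0 : ℝ) 1 := by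
  refine ⟨tsum_nonneg fun x => mul_nonneg (hg x).1 ENNReal.toReal_nonneg, ?_⟩
  rw [← ENNReal.ofReal_le_one, ofReal_mean μ hg]
  exact tsum_ofReal_mul_le_one μ fun x => (hg x).2

theorem mean_bind (μ : PMF α) (k : α → PMF β) {g : β → ℝ} (hg : ∀ x, g x ∈ Set.Icc (0 : ℝ) 1) :
    mean (μ.bind k) g = mean μ fun x => mean (k x) g := by
  rw [mean_eq_toReal _ fun x => (hg x).1, mean_eq_toReal _ fun x => (mean_mem_Icc (k x) hg).1]
  congr 1
  simp only [ofReal_mean _ hg, PMF.bind_apply, ← ENNReal.tsum_mul_left, ← ENNReal.tsum_mul_right]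
  rw [ENNReal.tsum_comm]
  exact tsum_congr fun x => tsum_congr fun y => by ring

@[simp]
theorem mean_pure (x : α) (g : α → ℝ) : mean (PMF.pure x) g = g x := by
  rw [mean, tsum_eq_single x fun y hy => by simp [PMF.pure_apply, hy]]
  simp

theorem mean_map (μ : PMF α) (f : α → β) {g : β → ℝ} (hg : ∀ x, g x ∈ Set.Icc (0 : ℝ) 1) :
    mean (μ.map f) g = mean μ fun x => g (f x) := by
  rw [← PMF.bind_pure_comp, mean_bind _ _ hg]
  simp

theorem mean_zero (μ : PMF α) : mean μ (fun _ => 0) = 0 := by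
  simp [mean]

theorem mean_le_mean_add_mean_add (μ : PMF α) {g h k : α → ℝ} {e : ℝ}
    (hg : ∀ x, g x ∈ Set.Icc (0 : ℝ) 1) (hh : ∀ x, h x ∈ Set.Icc (0 : ℝ) 1)
    (hk : ∀ x, k x ∈ Set.Icc (0 : ℝ) 1) (hle : ∀ x ∈ μ.support, g x ≤ h x + k x + e) :
    mean μ g ≤ mean μ h + mean μ k + e := by
  have hsum : HasSum (fun x => (h x + k x + e) * (μ x).toReal) (mean μ h + mean μ k + e) := by
    have hconst := (summable_toReal μ).hasSum.mul_left e
    rw [tsum_toReal, mul_one] at hconst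
    simpa only [add_mul, mean] using
      ((summable_mul_toReal μ hh).hasSum.add (summable_mul_toReal μ hk).hasSum).add hconst
  refine hasSum_le (fun x => ?_) (summable_mul_toReal μ hg).hasSum hsum
  by_cases hx : x ∈ μ.support
  · exact mul_le_mul_of_nonneg_right (hle x hx) ENNReal.toReal_nonneg
  · simp [(μ.apply_eq_zero_iff x).2 hx]

theorem mean_le_mean_add (μ : PMF α) {g h : α → ℝ} {e : ℝ} (hg : ∀ x, g x ∈ Set.Icc (0 : ℝ) 1)
    (hh : ∀ x, h x ∈ Set.Icc (0 : ℝ) 1) (hle : ∀ x ∈ μ.support, g x ≤ h x + e) :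
    mean μ g ≤ mean μ h + e := by
  simpa [mean_zero] using mean_le_mean_add_mean_add (k := fun _ => 0) (e := e) μ hg hh
    (fun _ => by simp) (fun x hx => by simpa using hle x hx)

theorem mean_mono (μ : PMF α) {g h : α → ℝ} (hg : ∀ x, g x ∈ Set.Icc (0 : ℝ) 1)
    (hh : ∀ x, h x ∈ Set.Icc (0 : ℝ) 1) (hle : ∀ x ∈ μ.support, g x ≤ h x) :
    mean μ g ≤ mean μ h := by
  simpa using mean_le_mean_add (e := 0) μ hg hh (fun x hx => by simpa using hle x hx)

theorem mean_le_of_le (μ : PMF α) {g : α → ℝ} {e : ℝ} (hg : ∀ x, g x ∈ Set.Icc (0 : ℝ) 1)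
    (hle : ∀ x ∈ μ.support, g x ≤ e) : mean μ g ≤ e := by
  simpa [mean_zero] using mean_le_mean_add (h := fun _ => 0) (e := e) μ hg (fun _ => by simp)
    (fun x hx => by simpa using hle x hx)

theorem mean_eq_sum [Fintype α] (μ : PMF α) (g : α → ℝ) :
    mean μ g = ∑ x, g x * (μ x).toReal :=
  tsum_fintype _

end Mean

/-- The Bernoulli distribution on `Bool` giving `true` the probability `q`, for real `q`; binary
mixtures and convex combinations are obtained from it by `PMF.map` and `PMF.bind`. -/
def coin (q : Set.Icc (0 : ℝ) 1) : PMF Bool :=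
  PMF.ofFintype (fun b => ENNReal.ofReal (cond b (q : ℝ) (1 - q))) (by
    rw [← ENNReal.ofReal_sum_of_nonneg]
    · simp
    · rintro (_ | _) _
      · simpa using q.2.2
      · exact q.2.1)

/-- The two-point distribution giving `y` the probability `q` and `x` the probability `1 - q`. The
degenerate weights `0` and `1` are allowed, unlike in `convexComb`. -/
def mix {S : Type*} (q : Set.Icc (0 : ℝ) 1) (x y : S) : PMF S :=
  (coin q).map fun b => cond b y x

section Mix

variable {S : Type*}

theorem mean_coin (q : Set.Icc (0 : ℝ) 1) (g : Bool → ℝ) :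
    mean (coin q) g = (1 - q) * g false + q * g true := by
  have h1 : (0 : ℝ) ≤ 1 - q := sub_nonneg.2 q.2.2
  rw [mean_eq_sum]
  simp only [coin, PMF.ofFintype_apply, Fintype.sum_bool, cond_true, cond_false,
    ENNReal.toReal_ofReal q.2.1, ENNReal.toReal_ofReal h1]
  ring

theorem mean_mix (q : Set.Icc (0 : ℝ) 1) (x y : S) {g : S → ℝ}
    (hg : ∀ x, g x ∈ Set.Icc (0 : ℝ) 1) :
    mean (mix q x y) g = (1 - q) * g x + q * g y := by
  rw [mix, mean_map _ _ hg, mean_coin]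
  rfl

theorem mix_zero (x y : S) : mix ⟨0, by simp⟩ x y = PMF.pure x := by
  ext z
  rw [mix, PMF.map_apply, tsum_fintype, PMF.pure_apply]
  simp [coin]

theorem mix_one (x y : S) : mix ⟨1, by simp⟩ x y = PMF.pure y := by
  ext z
  rw [mix, PMF.map_apply, tsum_fintype, PMF.pure_apply]
  simp [coin]

theorem convexComb_eq_bind (p : Set.Ioo (0 : ℝ) 1) (μ ν : PMF S) :
    convexComb p μ ν = (coin ⟨p, Set.Ioo_subset_Icc_self p.2⟩).bind fun b => cond b μ ν := by
  ext z
  rw [PMF.bind_apply, tsum_fintype, Fintype.sum_bool]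
  rfl

theorem mean_liftOp (f : S → S → S) (μ ν : PMF S) {g : S → ℝ}
    (hg : ∀ x, g x ∈ Set.Icc (0 : ℝ) 1) :
    mean (liftOp f μ ν) g = mean μ fun x => mean ν fun y => g (f x y) := by
  rw [liftOp, mean_bind _ _ hg]
  simp only [mean_map _ _ hg]

theorem liftOp_swap (f : S → S → S) (μ ν : PMF S) :
    liftOp (fun x y => f y x) μ ν = liftOp f ν μ := by
  simp only [liftOp, ← PMF.bind_pure_comp, Function.comp_def]
  exact PMF.bind_comm _ _ _

@[simp]
theorem liftOp_pure_pure (f : S → S → S) (x y : S) :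
    liftOp f (PMF.pure x) (PMF.pure y) = PMF.pure (f x y) := by
  simp [liftOp, PMF.pure_map]

theorem convexComb_symm (p : Set.Ioo (0 : ℝ) 1) (μ ν : PMF S) :
    convexComb p μ ν = convexComb ⟨1 - p, sub_pos.2 p.2.2, sub_lt_self 1 p.2.1⟩ ν μ := by
  ext z
  change ENNReal.ofReal p * μ z + ENNReal.ofReal (1 - p) * ν z =
    ENNReal.ofReal (1 - p) * ν z + ENNReal.ofReal (1 - (1 - p)) * μ z
  rw [sub_sub_cancel, add_comm]

end Mix

theorem IsBoundedPseudometric.mem_Icc {S : Type*} {d : S → S → ℝ} (hd : IsBoundedPseudometric d)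
    (x y : S) : d x y ∈ Set.Icc (0 : ℝ) 1 :=
  ⟨hd.nonneg x y, hd.le_one x y⟩

section Couplings

variable {S T U : Type*}

theorem matchings_nonempty (π π' : PMF S) : (matchings π π').Nonempty := by
  refine ⟨π.bind fun x => π'.map fun y => (x, y), ?_, ?_⟩
  · have hconst (x : S) : π'.map (fun _ => x) = PMF.pure x := PMF.map_const π' x
    simp [PMF.map_bind, PMF.map_comp, Function.comp_def, hconst]
  · have hid : π'.map (fun y => y) = π' := PMF.map_id π'
    simp [PMF.map_bind, PMF.map_comp, Function.comp_def, hid]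

theorem support_of_mem_matchings {π π' : PMF S} {ω : PMF (S × S)} (hω : ω ∈ matchings π π')
    {x : S × S} (hx : x ∈ ω.support) : x.1 ∈ π.support ∧ x.2 ∈ π'.support := by
  rw [← hω.1, ← hω.2, PMF.mem_support_map_iff, PMF.mem_support_map_iff]
  exact ⟨⟨x, hx, rfl⟩, ⟨x, hx, rfl⟩⟩

theorem swap_mem_matchings {π π' : PMF S} {ω : PMF (S × S)} (hω : ω ∈ matchings π π') :
    ω.map Prod.swap ∈ matchings π' π := by
  constructor <;> rw [PMF.map_comp]
  · exact hω.2
  · exact hω.1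

theorem map_fst_apply (ω : PMF (S × T)) (x : S) : ω.map Prod.fst x = ∑' y, ω (x, y) := by
  classical
  rw [PMF.map_apply, ENNReal.tsum_prod', tsum_eq_single x]
  · simp
  · intro x' hx'
    simp [Ne.symm hx']

theorem map_prodMk_apply_self (μ : PMF T) (x : S) (y : T) :
    (μ.map fun y => (x, y)) (x, y) = μ y := by
  classical
  rw [PMF.map_apply, tsum_eq_single y fun z hz => by simp [Ne.symm hz], if_pos rfl]

theorem exists_disintegration (ω : PMF (S × T)) :
    ∃ k : S → PMF T, (ω.map Prod.fst).bind (fun x => (k x).map fun y => (x, y)) = ω := by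
  classical
  have htop : ∀ x, ∑' y, ω (x, y) ≠ ∞ := fun x => map_fst_apply ω x ▸ PMF.apply_ne_top _ x
  refine ⟨fun x => if h : ∑' y, ω (x, y) ≠ 0 then PMF.normalize (fun y => ω (x, y)) h (htop x)
    else ω.map Prod.snd, ?_⟩
  ext ⟨x, y⟩
  rw [PMF.bind_apply, tsum_eq_single x]
  · rw [map_fst_apply, map_prodMk_apply_self]
    by_cases h : ∑' y, ω (x, y) = 0
    · rw [h, zero_mul]
      exact (ENNReal.tsum_eq_zero.1 h y).symm
    · beta_reduce
      rw [dif_pos (show _ ≠ _ from h), PMF.normalize_apply, mul_comm, mul_assoc,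
        ENNReal.inv_mul_cancel h (htop x), mul_one]
  · intro x' hx'
    rw [PMF.map_apply]
    simp [Ne.symm hx']

theorem exists_gluing {ω : PMF (S × T)} {ω' : PMF (T × U)}
    (h : ω.map Prod.snd = ω'.map Prod.fst) :
    ∃ Ω : PMF (S × T × U), Ω.map (fun q => (q.1, q.2.1)) = ω ∧ Ω.map Prod.snd = ω' := by
  obtain ⟨k, hk⟩ := exists_disintegration ω'
  rw [← h, PMF.bind_map] at hk
  refine ⟨ω.bind fun p => (k p.2).map fun z => (p.1, p.2, z), ?_, ?_⟩
  · have hconst (p : S × T) : (k p.2).map (fun _ => p) = PMF.pure p := PMF.map_const _ p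
    simp [PMF.map_bind, PMF.map_comp, Function.comp_def, hconst]
  · simpa only [PMF.map_bind, PMF.map_comp, Function.comp_def] using hk

end Couplings

section Kantorovich

variable {S : Type*} {d : S → S → ℝ}

theorem kantorovich_eq (d : S → S → ℝ) (π π' : PMF S) :
    kantorovich d π π' =
      sInf ((fun ω : PMF (S × S) => mean ω fun x => d x.1 x.2) '' matchings π π') := rfl

theorem le_kantorovich {π π' : PMF S} {c : ℝ}
    (h : ∀ ω ∈ matchings π π', c ≤ mean ω fun x => d x.1 x.2) : c ≤ kantorovich d π π' := by
  rw [kantorovich_eq]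
  refine le_csInf ((matchings_nonempty π π').image _) ?_
  rintro _ ⟨ω, hω, rfl⟩
  exact h ω hω

theorem exists_matching_lt (d : S → S → ℝ) (π π' : PMF S) {e : ℝ} (he : 0 < e) :
    ∃ ω ∈ matchings π π', (mean ω fun x => d x.1 x.2) < kantorovich d π π' + e := by
  rw [kantorovich_eq]
  obtain ⟨_, ⟨ω, hω, rfl⟩, h⟩ :=
    Real.lt_sInf_add_pos ((matchings_nonempty π π').image
      (fun ω : PMF (S × S) => mean ω fun x => d x.1 x.2)) he
  exact ⟨ω, hω, h⟩

theorem kantorovich_le_mean (hd : ∀ x y, d x y ∈ Set.Icc (0 : ℝ) 1) {π π' : PMF S}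
    {ω : PMF (S × S)} (hω : ω ∈ matchings π π') :
    kantorovich d π π' ≤ mean ω fun x => d x.1 x.2 := by
  rw [kantorovich_eq]
  refine csInf_le ⟨0, ?_⟩ ⟨ω, hω, rfl⟩
  rintro _ ⟨ω', -, rfl⟩
  exact (mean_mem_Icc ω' fun x => hd x.1 x.2).1

theorem kantorovich_mem_Icc (hd : ∀ x y, d x y ∈ Set.Icc (0 : ℝ) 1) (π π' : PMF S) :
    kantorovich d π π' ∈ Set.Icc (0 : ℝ) 1 := by
  refine ⟨le_kantorovich fun ω _ => (mean_mem_Icc ω fun x => hd x.1 x.2).1, ?_⟩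
  obtain ⟨ω, hω⟩ := matchings_nonempty π π'
  exact (kantorovich_le_mean hd hω).trans (mean_mem_Icc ω fun x => hd x.1 x.2).2

theorem kantorovich_mono {d' : S → S → ℝ} (hd : ∀ x y, d x y ∈ Set.Icc (0 : ℝ) 1)
    (hd' : ∀ x y, d' x y ∈ Set.Icc (0 : ℝ) 1) {π π' : PMF S}
    (h : ∀ x ∈ π.support, ∀ y ∈ π'.support, d x y ≤ d' x y) :
    kantorovich d π π' ≤ kantorovich d' π π' := by
  refine le_kantorovich fun ω hω => (kantorovich_le_mean hd hω).trans ?_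
  refine mean_mono _ (fun x => hd _ _) (fun x => hd' _ _) fun x hx => ?_
  obtain ⟨h1, h2⟩ := support_of_mem_matchings hω hx
  exact h _ h1 _ h2

theorem mean_le_kantorovich (hd : ∀ x y, d x y ∈ Set.Icc (0 : ℝ) 1) {π π' : PMF S} {g : S → ℝ}
    (hg : ∀ x, g x ∈ Set.Icc (0 : ℝ) 1)
    (h : ∀ x ∈ π.support, ∀ y ∈ π'.support, g x ≤ d x y) :
    mean π g ≤ kantorovich d π π' := by
  refine le_kantorovich fun ω hω => ?_
  nth_rw 1 [← hω.1]
  rw [mean_map _ _ hg]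
  refine mean_mono _ (fun x => hg _) (fun x => hd _ _) fun x hx => ?_
  obtain ⟨h1, h2⟩ := support_of_mem_matchings hω hx
  exact h _ h1 _ h2

theorem kantorovich_pure_right (hd : ∀ x y, d x y ∈ Set.Icc (0 : ℝ) 1) (π : PMF S) (z : S) :
    kantorovich d π (PMF.pure z) = mean π fun x => d x z := by
  refine le_antisymm ?_ (mean_le_kantorovich hd (fun x => hd _ _) ?_)
  · have hω : π.map (fun x => (x, z)) ∈ matchings π (PMF.pure z) := by
      constructor <;> rw [PMF.map_comp]
      · exact PMF.map_id π
      · exact PMF.map_const π z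
    refine (kantorovich_le_mean hd hω).trans ?_
    rw [mean_map _ _ fun x : S × S => hd x.1 x.2]
  · intro x _ y hy
    rw [(PMF.mem_support_pure_iff _ _).1 hy]

theorem kantorovich_pure_pure (hd : ∀ x y, d x y ∈ Set.Icc (0 : ℝ) 1) (x y : S) :
    kantorovich d (PMF.pure x) (PMF.pure y) = d x y := by
  rw [kantorovich_pure_right hd, mean_pure]

theorem kantorovich_mix_pure (hd : ∀ x y, d x y ∈ Set.Icc (0 : ℝ) 1) (q : Set.Icc (0 : ℝ) 1)
    (x y z : S) : kantorovich d (mix q x y) (PMF.pure z) = (1 - q) * d x z + q * d y z := by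
  rw [kantorovich_pure_right hd, mean_mix _ _ _ fun w => hd w z]

theorem kantorovich_liftOp_pure_right (hd : ∀ x y, d x y ∈ Set.Icc (0 : ℝ) 1) (f : S → S → S)
    (μ ν : PMF S) (z : S) :
    kantorovich d (liftOp f μ ν) (PMF.pure z) = mean μ fun x => mean ν fun y => d (f x y) z := by
  rw [kantorovich_pure_right hd, mean_liftOp f μ ν fun w => hd w z]

theorem kantorovich_liftOp_mix_pure (hd : ∀ x y, d x y ∈ Set.Icc (0 : ℝ) 1) (f : S → S → S)
    (q : Set.Icc (0 : ℝ) 1) (x y u v z : S) :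
    kantorovich d (liftOp f (mix q x y) (PMF.pure u)) (liftOp f (PMF.pure v) (PMF.pure z)) =
      (1 - q) * d (f x u) (f v z) + q * d (f y u) (f v z) := by
  simp only [liftOp_pure_pure, kantorovich_liftOp_pure_right hd, mean_pure,
    mean_mix _ _ _ fun w => hd (f w u) (f v z)]

theorem kantorovich_liftOp_pure_mix (hd : ∀ x y, d x y ∈ Set.Icc (0 : ℝ) 1) (f : S → S → S)
    (q : Set.Icc (0 : ℝ) 1) (x y u v z : S) :
    kantorovich d (liftOp f (PMF.pure u) (mix q x y)) (liftOp f (PMF.pure v) (PMF.pure z)) =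
      (1 - q) * d (f u x) (f v z) + q * d (f u y) (f v z) := by
  simp only [← liftOp_swap f]
  exact kantorovich_liftOp_mix_pure hd (fun x y => f y x) q x y u z v

theorem kantorovich_self (hd : IsBoundedPseudometric d) (π : PMF S) : kantorovich d π π = 0 := by
  refine le_antisymm ?_ (kantorovich_mem_Icc hd.mem_Icc π π).1
  have hω : π.map (fun x => (x, x)) ∈ matchings π π := by
    constructor <;> rw [PMF.map_comp] <;> exact PMF.map_id π
  refine (kantorovich_le_mean hd.mem_Icc hω).trans ?_
  rw [mean_map _ _ fun x : S × S => hd.mem_Icc x.1 x.2]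
  simp [hd.self, mean_zero]

theorem kantorovich_comm (hd : IsBoundedPseudometric d) (π π' : PMF S) :
    kantorovich d π π' = kantorovich d π' π := by
  have hle (π π' : PMF S) : kantorovich d π π' ≤ kantorovich d π' π := by
    refine le_kantorovich fun ω hω =>
      (kantorovich_le_mean hd.mem_Icc (swap_mem_matchings hω)).trans ?_
    rw [mean_map _ _ fun x : S × S => hd.mem_Icc x.1 x.2]
    simp [hd.symm]
  exact le_antisymm (hle _ _) (hle _ _)

theorem kantorovich_triangle (hd : IsBoundedPseudometric d) (π₁ π₂ π₃ : PMF S) :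
    kantorovich d π₁ π₃ ≤ kantorovich d π₁ π₂ + kantorovich d π₂ π₃ := by
  refine le_of_forall_pos_le_add fun e he => ?_
  obtain ⟨ω, hω, hlt⟩ := exists_matching_lt d π₁ π₂ (half_pos he)
  obtain ⟨ω', hω', hlt'⟩ := exists_matching_lt d π₂ π₃ (half_pos he)
  obtain ⟨Ω, rfl, rfl⟩ := exists_gluing (hω.2.trans hω'.1.symm)
  have hΩ : Ω.map (fun q => (q.1, q.2.2)) ∈ matchings π₁ π₃ := by
    constructor
    · rw [← hω.1, PMF.map_comp, PMF.map_comp]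
      rfl
    · rw [← hω'.2, PMF.map_comp, PMF.map_comp]
      rfl
  have hb (x : S × S) : d x.1 x.2 ∈ Set.Icc (0 : ℝ) 1 := hd.mem_Icc _ _
  have hmean := kantorovich_le_mean hd.mem_Icc hΩ
  rw [mean_map _ _ hb] at hlt hlt' hmean
  have htri := mean_le_mean_add_mean_add (e := 0) Ω (fun q => hb (q.1, q.2.2))
    (fun q => hb (q.1, q.2.1)) (fun q => hb q.2)
    fun q _ => by simpa using hd.triangle q.1 q.2.1 q.2.2
  linarith

theorem kantorovich_bind_le {I : Type*} (hd : ∀ x y, d x y ∈ Set.Icc (0 : ℝ) 1) (τ : PMF I)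
    (μ ν : I → PMF S) :
    kantorovich d (τ.bind μ) (τ.bind ν) ≤ mean τ fun i => kantorovich d (μ i) (ν i) := by
  refine le_of_forall_pos_le_add fun e he => ?_
  choose ω hω hlt using fun i => exists_matching_lt d (μ i) (ν i) he
  have hτω : τ.bind ω ∈ matchings (τ.bind μ) (τ.bind ν) := by
    constructor <;> rw [PMF.map_bind] <;> congr 1 <;> funext i
    · exact (hω i).1
    · exact (hω i).2
  refine (kantorovich_le_mean hd hτω).trans ?_
  rw [mean_bind _ _ fun x : S × S => hd x.1 x.2]
  exact mean_le_mean_add _ (fun i => mean_mem_Icc _ fun x => hd _ _)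
    (fun i => kantorovich_mem_Icc hd _ _) fun i _ => (hlt i).le

theorem kantorovich_convexComb_le (hd : ∀ x y, d x y ∈ Set.Icc (0 : ℝ) 1) (p : Set.Ioo (0 : ℝ) 1)
    (μ μ' ν ν' : PMF S) :
    kantorovich d (convexComb p μ ν) (convexComb p μ' ν') ≤
      max (kantorovich d μ μ') (kantorovich d ν ν') := by
  rw [convexComb_eq_bind, convexComb_eq_bind]
  refine (kantorovich_bind_le hd _ _ _).trans
    (mean_le_of_le _ (fun b => kantorovich_mem_Icc hd _ _) ?_)
  rintro (_ | _) -
  · exact le_max_right _ _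
  · exact le_max_left _ _

theorem mul_kantorovich_convexComb_le (hd : ∀ x y, d x y ∈ Set.Icc (0 : ℝ) 1) {lam c : ℝ}
    (hlam : 0 ≤ lam) (p : Set.Ioo (0 : ℝ) 1) {μ μ' ν ν' : PMF S}
    (hμ : lam * kantorovich d μ μ' ≤ c) (hν : lam * kantorovich d ν ν' ≤ c) :
    lam * kantorovich d (convexComb p μ ν) (convexComb p μ' ν') ≤ c := by
  refine (mul_le_mul_of_nonneg_left (kantorovich_convexComb_le hd p μ μ' ν ν') hlam).trans ?_
  rw [mul_max_of_nonneg _ _ hlam]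
  exact max_le hμ hν

theorem map_liftOp_mem_matchings (f : S → S → S) {μ μ' ν ν' : PMF S} {ω ω' : PMF (S × S)}
    (hω : ω ∈ matchings μ μ') (hω' : ω' ∈ matchings ν ν') :
    (ω.bind fun p => ω'.map fun q => (f p.1 q.1, f p.2 q.2)) ∈
      matchings (liftOp f μ ν) (liftOp f μ' ν') := by
  obtain ⟨rfl, rfl⟩ := hω
  obtain ⟨rfl, rfl⟩ := hω'
  constructor <;> simp [liftOp, PMF.map_bind, PMF.bind_map, PMF.map_comp, Function.comp_def]

theorem kantorovich_liftOp_le {e : S → S → ℝ} (hd : ∀ x y, d x y ∈ Set.Icc (0 : ℝ) 1)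
    (he : ∀ x y, e x y ∈ Set.Icc (0 : ℝ) 1) {f : S → S → S}
    (h : ∀ x x' y y', e (f x y) (f x' y') ≤ d x x' + d y y') (μ μ' ν ν' : PMF S) :
    kantorovich e (liftOp f μ ν) (liftOp f μ' ν') ≤ kantorovich d μ μ' + kantorovich d ν ν' := by
  refine le_of_forall_pos_le_add fun ε hε => ?_
  obtain ⟨ω, hω, hlt⟩ := exists_matching_lt d μ μ' (half_pos hε)
  obtain ⟨ω', hω', hlt'⟩ := exists_matching_lt d ν ν' (half_pos hε)
  have hb (x : S × S) : d x.1 x.2 ∈ Set.Icc (0 : ℝ) 1 := hd _ _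
  have hb' (x : S × S) : e x.1 x.2 ∈ Set.Icc (0 : ℝ) 1 := he _ _
  have hmean := kantorovich_le_mean he (map_liftOp_mem_matchings f hω hω')
  rw [mean_bind _ _ hb'] at hmean
  simp only [mean_map _ _ hb'] at hmean
  have hle : (mean ω fun p => mean ω' fun q => e (f p.1 q.1) (f p.2 q.2)) ≤
      (mean ω fun x => d x.1 x.2) + mean ω' fun x => d x.1 x.2 := by
    refine mean_le_mean_add _ (fun p => mean_mem_Icc _ fun q => he _ _) hb fun p _ => ?_
    rw [add_comm]
    refine mean_le_mean_add _ (fun q => he _ _) hb fun q _ => ?_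
    rw [add_comm]
    exact h _ _ _ _
  linarith

end Kantorovich

section TransitionSystem

variable {S A : Type*} {tr : S → A → PMF S → Prop} {lam c c' : ℝ} {d d' : S → S → ℝ}
  {x y z : S}

/-- The action `a` is enabled at `x` in the transition system `tr`. -/
def Can (tr : S → A → PMF S → Prop) (x : S) (a : A) : Prop := ∃ π, tr x a π

/-- One direction of the transfer property of a bisimulation metric, with the bound `c` in place of
`d x y`: every transition of `x` is matched by a transition of `y` at discounted distance at most
`c`. -/
def Simulates (tr : S → A → PMF S → Prop) (lam : ℝ) (d : S → S → ℝ) (c : ℝ) (x y : S) : Prop :=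
  ∀ a π, tr x a π → ∃ π', tr y a π' ∧ lam * kantorovich d π π' ≤ c

namespace Simulates

theorem can (h : Simulates tr lam d c x y) {a : A} (hx : Can tr x a) : Can tr y a :=
  let ⟨π, hπ⟩ := hx
  let ⟨π', hπ', _⟩ := h a π hπ
  ⟨π', hπ'⟩

theorem mono (h : Simulates tr lam d c x y) (hc : c ≤ c') : Simulates tr lam d c' x y :=
  fun a π hπ => let ⟨π', hπ', hle⟩ := h a π hπ; ⟨π', hπ', hle.trans hc⟩

theorem anti_dist (hlam : 0 ≤ lam) (hd : ∀ x y, d x y ∈ Set.Icc (0 : ℝ) 1)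
    (hd' : ∀ x y, d' x y ∈ Set.Icc (0 : ℝ) 1) (hle : d ≤ d') (h : Simulates tr lam d' c x y) :
    Simulates tr lam d c x y := fun a π hπ =>
  let ⟨π', hπ', hc⟩ := h a π hπ
  ⟨π', hπ', (mul_le_mul_of_nonneg_left
    (kantorovich_mono hd hd' fun u _ v _ => hle u v) hlam).trans hc⟩

theorem refl (hd : IsBoundedPseudometric d) (x : S) : Simulates tr lam d 0 x x :=
  fun _ π hπ => ⟨π, hπ, by rw [kantorovich_self hd, mul_zero]⟩

theorem trans (hlam : 0 ≤ lam) (hd : IsBoundedPseudometric d)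
    (h : Simulates tr lam d c x y) (h' : Simulates tr lam d c' y z) :
    Simulates tr lam d (c + c') x z := by
  intro a π hπ
  obtain ⟨π', hπ', hc⟩ := h a π hπ
  obtain ⟨π'', hπ'', hc'⟩ := h' a π' hπ'
  refine ⟨π'', hπ'', ?_⟩
  have htri := mul_le_mul_of_nonneg_left (kantorovich_triangle hd π π' π'') hlam
  linarith

theorem of_not_can (h : ∀ a, ¬ Can tr x a) : Simulates tr lam d c x y :=
  fun a π hπ => (h a ⟨π, hπ⟩).elim

end Simulates

/-- The numbers in `[0, 1]` that bound the distance of `x` and `y` after one step, when the targets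
of transitions are compared by `d`. The bound `1` is always admissible. -/
def stepBounds (tr : S → A → PMF S → Prop) (lam : ℝ) (d : S → S → ℝ) (x y : S) : Set ℝ :=
  {c | c ∈ Set.Icc 0 1 ∧ (c < 1 → Simulates tr lam d c x y ∧ Simulates tr lam d c y x)}

/-- The bisimulation functional, whose prefixed points among the bounded pseudometrics are the
bisimulation metrics of an image-finite system. -/
def stepDist (tr : S → A → PMF S → Prop) (lam : ℝ) (d : S → S → ℝ) (x y : S) : ℝ :=
  sInf (stepBounds tr lam d x y)

theorem one_mem_stepBounds : 1 ∈ stepBounds tr lam d x y :=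
  ⟨by simp, fun h => absurd h (lt_irrefl 1)⟩

theorem stepDist_le (hc : c ∈ stepBounds tr lam d x y) : stepDist tr lam d x y ≤ c :=
  csInf_le ⟨0, fun _ h => h.1.1⟩ hc

theorem stepDist_le_one : stepDist tr lam d x y ≤ 1 :=
  stepDist_le one_mem_stepBounds

theorem stepDist_le_of_simulates (hc : 0 ≤ c) (hxy : Simulates tr lam d c x y)
    (hyx : Simulates tr lam d c y x) : stepDist tr lam d x y ≤ c := by
  rcases le_total c 1 with h | h
  · exact stepDist_le ⟨⟨hc, h⟩, fun _ => ⟨hxy, hyx⟩⟩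
  · exact stepDist_le_one.trans h

theorem stepDist_nonneg : 0 ≤ stepDist tr lam d x y :=
  Real.sInf_nonneg fun _ h => h.1.1

theorem stepBounds_comm : stepBounds tr lam d x y = stepBounds tr lam d y x := by
  ext c
  simp only [stepBounds, Set.mem_ofPred_eq, and_comm (a := Simulates tr lam d c x y)]

theorem add_mem_stepBounds (hlam : 0 ≤ lam) (hd : IsBoundedPseudometric d)
    (hc : c ∈ stepBounds tr lam d x y) (hc' : c' ∈ stepBounds tr lam d y z) (hlt : c + c' < 1) :
    c + c' ∈ stepBounds tr lam d x z := by
  obtain ⟨⟨hc0, -⟩, hsim⟩ := hc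
  obtain ⟨⟨hc0', -⟩, hsim'⟩ := hc'
  obtain ⟨hxy, hyx⟩ := hsim (by linarith)
  obtain ⟨hyz, hzy⟩ := hsim' (by linarith)
  exact ⟨⟨by linarith, hlt.le⟩,
    fun _ => ⟨hxy.trans hlam hd hyz, add_comm c' c ▸ hzy.trans hlam hd hyx⟩⟩

theorem isBoundedPseudometric_stepDist (hlam : 0 ≤ lam) (hd : IsBoundedPseudometric d) :
    IsBoundedPseudometric (stepDist tr lam d) where
  nonneg x y := stepDist_nonneg
  le_one x y := stepDist_le_one
  self x := le_antisymm
    (stepDist_le_of_simulates le_rfl (Simulates.refl hd x) (Simulates.refl hd x)) stepDist_nonneg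
  symm x y := by rw [stepDist, stepBounds_comm, stepDist]
  triangle x y z := by
    refine le_of_forall_pos_le_add fun e he => ?_
    obtain ⟨c, hc, hlt⟩ := Real.lt_sInf_add_pos
      ⟨1, one_mem_stepBounds (tr := tr) (lam := lam) (d := d) (x := x) (y := y)⟩ (half_pos he)
    obtain ⟨c', hc', hlt'⟩ := Real.lt_sInf_add_pos
      ⟨1, one_mem_stepBounds (tr := tr) (lam := lam) (d := d) (x := y) (y := z)⟩ (half_pos he)
    have hle : stepDist tr lam d x z ≤ c + c' := by
      rcases le_or_gt 1 (c + c') with h | h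
      · exact stepDist_le_one.trans h
      · exact stepDist_le (add_mem_stepBounds hlam hd hc hc' h)
    simp only [stepDist] at hle ⊢
    linarith

theorem stepDist_mono (hlam : 0 ≤ lam) (hd : ∀ x y, d x y ∈ Set.Icc (0 : ℝ) 1)
    (hd' : ∀ x y, d' x y ∈ Set.Icc (0 : ℝ) 1) (h : d ≤ d') :
    stepDist tr lam d ≤ stepDist tr lam d' := fun _ _ =>
  csInf_le_csInf ⟨0, fun _ hc => hc.1.1⟩ ⟨1, one_mem_stepBounds⟩ fun _ hc => ⟨hc.1, fun hlt =>
    ⟨(hc.2 hlt).1.anti_dist hlam hd hd' h, (hc.2 hlt).2.anti_dist hlam hd hd' h⟩⟩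

theorem simulates_stepDist (hfin : ∀ x a, {π | tr x a π}.Finite)
    (h : stepDist tr lam d x y < 1) :
    Simulates tr lam d (stepDist tr lam d x y) x y := by
  intro a π hπ
  by_contra! hlt
  have hgap : ∀ᶠ b in nhdsWithin (stepDist tr lam d x y) (Set.Ioi (stepDist tr lam d x y)),
      ∀ π' ∈ {π' | tr y a π'}, b < lam * kantorovich d π π' :=
    (Filter.eventually_all_finite (hfin y a)).2 fun π' hπ' =>
      nhdsWithin_le_nhds (eventually_lt_nhds (hlt π' hπ'))
  have hone : ∀ᶠ b in nhdsWithin (stepDist tr lam d x y) (Set.Ioi (stepDist tr lam d x y)),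
      b < 1 := nhdsWithin_le_nhds (eventually_lt_nhds h)
  obtain ⟨b, hb, hb1, hsb⟩ := (hgap.and (hone.and self_mem_nhdsWithin)).exists
  obtain ⟨c, hc, hcb⟩ := exists_lt_of_csInf_lt ⟨1, one_mem_stepBounds⟩ hsb
  obtain ⟨π', hπ', hle⟩ := (hc.2 (hcb.trans hb1)).1 a π hπ
  linarith [hb π' hπ']

theorem isBisimMetric_of_stepDist_le (hfin : ∀ x a, {π | tr x a π}.Finite)
    (hd : IsBoundedPseudometric d) (h : stepDist tr lam d ≤ d) : IsBisimMetric tr lam d where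
  isBoundedPseudometric := hd
  transfer x y hlt := (simulates_stepDist hfin ((h x y).trans_lt hlt)).mono (h x y)

namespace IsBisimMetric

variable {a : A}

theorem simulates (hd : IsBisimMetric tr lam d) (h : d x y < 1) :
    Simulates tr lam d (d x y) x y :=
  hd.transfer x y h

theorem simulates_symm (hd : IsBisimMetric tr lam d) (h : d x y < 1) :
    Simulates tr lam d (d x y) y x := by
  rw [hd.isBoundedPseudometric.symm] at h ⊢
  exact hd.transfer y x h

theorem stepDist_le_self (hd : IsBisimMetric tr lam d) : stepDist tr lam d ≤ d := fun x y =>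
  stepDist_le ⟨hd.isBoundedPseudometric.mem_Icc x y,
    fun h => ⟨hd.simulates h, hd.simulates_symm h⟩⟩

theorem can_iff_of_lt (hd : IsBisimMetric tr lam d) (h : d x y < 1) (a : A) :
    Can tr x a ↔ Can tr y a :=
  ⟨(hd.simulates h).can, (hd.simulates_symm h).can⟩

theorem eq_one_of_can_left (hd : IsBisimMetric tr lam d) (hx : Can tr x a) (hy : ¬ Can tr y a) :
    d x y = 1 :=
  le_antisymm (hd.isBoundedPseudometric.le_one x y)
    (not_lt.1 fun h => hy ((hd.can_iff_of_lt h a).1 hx))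

theorem eq_one_of_can_right (hd : IsBisimMetric tr lam d) (hx : ¬ Can tr x a) (hy : Can tr y a) :
    d x y = 1 := by
  rw [hd.isBoundedPseudometric.symm, hd.eq_one_of_can_left hy hx]

theorem le_of_forall_le (hd : IsBisimMetric tr lam d) {π : PMF S} (hc : c ≤ 1) (hx : tr x a π)
    (h : ∀ π', tr y a π' → c ≤ lam * kantorovich d π π') : c ≤ d x y := by
  rcases lt_or_ge (d x y) 1 with hlt | hge
  · obtain ⟨π', hπ', hle⟩ := hd.simulates hlt a π hx
    exact (h π' hπ').trans hle
  · exact hc.trans hge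

theorem mul_kantorovich_le (hd : IsBisimMetric tr lam d) (hlam : lam ≤ 1) {π π' : PMF S}
    (hx : tr x a π) (hy : ∀ π'', tr y a π'' → π'' = π') : lam * kantorovich d π π' ≤ d x y := by
  have hK := kantorovich_mem_Icc hd.isBoundedPseudometric.mem_Icc π π'
  refine hd.le_of_forall_le (mul_le_one₀ hlam hK.1 hK.2) hx fun π'' h => ?_
  rw [hy π'' h]

end IsBisimMetric

theorem isBoundedPseudometric_iSup {I : Type*} [Nonempty I] {p : I → S → S → ℝ}
    (hp : ∀ i, IsBoundedPseudometric (p i)) :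
    IsBoundedPseudometric fun x y => ⨆ i, p i x y where
  nonneg x y := Real.iSup_nonneg fun i => (hp i).nonneg x y
  le_one x y := ciSup_le fun i => (hp i).le_one x y
  self x := by simp only [(hp _).self, ciSup_const]
  symm x y := by simp only [(hp _).symm x y]
  triangle x y z := by
    have hbdd (x y : S) : BddAbove (Set.range fun i => p i x y) :=
      ⟨1, Set.forall_mem_range.2 fun i => (hp i).le_one x y⟩
    exact ciSup_le fun i => ((hp i).triangle x y z).trans
      (add_le_add (le_ciSup (hbdd x y) i) (le_ciSup (hbdd y z) i))

-- Knaster–Tarski in the lattice of bounded pseudometrics, where suprema are computed pointwise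
-- (pointwise infima of pseudometrics need not be pseudometrics): the supremum of `C` is a prefixed
-- point of `stepDist`.
theorem exists_isBisimMetric_mem (hfin : ∀ x a, {π | tr x a π}.Finite) {C : Set (S → S → ℝ)}
    (hC : ∀ p ∈ C, IsBoundedPseudometric p) (hsup : (fun x y => ⨆ p : C, p.1 x y) ∈ C)
    (hstep : ∀ p ∈ C, stepDist tr lam p ∈ C) : ∃ m ∈ C, IsBisimMetric tr lam m :=
  ⟨_, hsup, isBisimMetric_of_stepDist_le hfin (hC _ hsup) fun x y =>
    le_ciSup (f := fun p : C => p.1 x y)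
      ⟨1, Set.forall_mem_range.2 fun p => (hC _ p.2).le_one x y⟩ ⟨_, hstep _ hsup⟩⟩

theorem isBoundedPseudometric_zero : IsBoundedPseudometric fun _ _ : S => (0 : ℝ) := by
  constructor <;> simp

theorem exists_isLeast_isBisimMetric (hlam : 0 ≤ lam) (hfin : ∀ x a, {π | tr x a π}.Finite) :
    ∃ m, IsLeast {d | IsBisimMetric tr lam d} m := by
  let C : Set (S → S → ℝ) := {p | IsBoundedPseudometric p ∧ ∀ d, IsBisimMetric tr lam d → p ≤ d}
  have : Nonempty C := ⟨_, isBoundedPseudometric_zero,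
    fun d hd x y => hd.isBoundedPseudometric.nonneg x y⟩
  obtain ⟨m, hmC, hm⟩ := exists_isBisimMetric_mem (tr := tr) (lam := lam) hfin (C := C)
    (fun p hp => hp.1)
    ⟨isBoundedPseudometric_iSup fun p => p.2.1, fun d hd x y => ciSup_le fun p => p.2.2 d hd x y⟩
    fun p hp => ⟨isBoundedPseudometric_stepDist hlam hp.1, fun d hd =>
      (stepDist_mono hlam hp.1.mem_Icc hd.isBoundedPseudometric.mem_Icc (hp.2 d hd)).trans
        hd.stepDist_le_self⟩
  exact ⟨m, hm, hmC.2⟩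

theorem isLeast_bisimDist (hlam : 0 ≤ lam) (hfin : ∀ x a, {π | tr x a π}.Finite) :
    IsLeast {d | IsBisimMetric tr lam d} (bisimDist tr lam) := by
  obtain ⟨m, hm, hle⟩ := exists_isLeast_isBisimMetric hlam hfin
  have heq : bisimDist tr lam = m := by
    funext x y
    refine IsLeast.csInf_eq ⟨⟨m, hm, rfl⟩, ?_⟩
    rintro _ ⟨d, hd, rfl⟩
    exact hle hd x y
  exact heq ▸ ⟨hm, hle⟩

-- Fixpoint induction: in a step, the bounds may be assumed for the targets of transitions.
theorem bisimDist_le_of_stepDist_le (hlam : 0 ≤ lam) (hfin : ∀ x a, {π | tr x a π}.Finite)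
    {I : Type*} {u v : I → S} {b : I → ℝ} (hb : ∀ i, 0 ≤ b i)
    (hstep : ∀ p, IsBoundedPseudometric p → p ≤ bisimDist tr lam → (∀ i, p (u i) (v i) ≤ b i) →
      ∀ i, stepDist tr lam p (u i) (v i) ≤ b i) (i : I) :
    bisimDist tr lam (u i) (v i) ≤ b i := by
  obtain ⟨hd, hle⟩ := isLeast_bisimDist (tr := tr) hlam hfin
  let C : Set (S → S → ℝ) :=
    {p | IsBoundedPseudometric p ∧ p ≤ bisimDist tr lam ∧ ∀ i, p (u i) (v i) ≤ b i}
  have : Nonempty C := ⟨_, isBoundedPseudometric_zero, hd.isBoundedPseudometric.nonneg, hb⟩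
  obtain ⟨m, hmC, hm⟩ := exists_isBisimMetric_mem (tr := tr) (lam := lam) hfin (C := C)
    (fun p hp => hp.1)
    ⟨isBoundedPseudometric_iSup fun p => p.2.1, fun x y => ciSup_le fun p => p.2.2.1 x y,
      fun i => ciSup_le fun p => p.2.2.2 i⟩
    fun p ⟨hp, hpd, hpb⟩ => ⟨isBoundedPseudometric_stepDist hlam hp,
      (stepDist_mono hlam hp.mem_Icc hd.isBoundedPseudometric.mem_Icc hpd).trans
        hd.stepDist_le_self, hstep p hp hpd hpb⟩
  exact (hle hm _ _).trans (hmC.2.2 i)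

theorem bisimDist_le_stepDist (hlam : 0 ≤ lam) (hfin : ∀ x a, {π | tr x a π}.Finite) (x y : S) :
    bisimDist tr lam x y ≤ stepDist tr lam (bisimDist tr lam) x y := by
  have hd := (isLeast_bisimDist (tr := tr) hlam hfin).1.isBoundedPseudometric
  exact bisimDist_le_of_stepDist_le hlam hfin (I := Unit) (u := fun _ => x) (v := fun _ => y)
    (b := fun _ => stepDist tr lam (bisimDist tr lam) x y) (fun _ => stepDist_nonneg)
    (fun p hp hpd _ _ => stepDist_mono hlam hp.mem_Icc hd.mem_Icc hpd x y) ()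

end TransitionSystem

theorem finite_step_pasync {A : Type*} {tick a : A} {x y : Proc A} (p : Set.Ioo (0 : ℝ) 1)
    (hx : {π | Step tick x a π}.Finite) (hy : {π | Step tick y a π}.Finite) :
    {π | Step tick (.pasync p x y) a π}.Finite := by
  have hl := hx.image fun μ => liftOp (.pasync p) μ (PMF.pure y)
  have hr := hy.image fun ν => liftOp (.pasync p) (PMF.pure x) ν
  refine (((hl.union hr).union (hl.image2 (convexComb p) hr)).insert (PMF.pure .nil)).subset ?_
  rintro π (⟨-, -, μ, hμ, rfl⟩ | ⟨-, -, ν, hν, rfl⟩ | ⟨-, μ, ν, hμ, hν, rfl⟩ | ⟨-, -, -, rfl⟩)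
  · exact Or.inr (Or.inl (Or.inl ⟨μ, hμ, rfl⟩))
  · exact Or.inr (Or.inl (Or.inr ⟨ν, hν, rfl⟩))
  · exact Or.inr (Or.inr ⟨_, ⟨μ, hμ, rfl⟩, _, ⟨ν, hν, rfl⟩, rfl⟩)
  · exact Or.inl rfl

theorem finite_step {A : Type*} (tick : A) (x : Proc A) (a : A) : {π | Step tick x a π}.Finite := by
  induction x with
  | nil => exact Set.finite_empty
  | skip => exact (Set.finite_singleton (PMF.pure (Proc.nil : Proc A))).subset fun π h => h.2
  | pre b p t => exact (Set.finite_singleton (p.toPMF.map t)).subset fun π h => h.2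
  | seq x y ihx ihy =>
    refine ((ihx.image fun μ => liftOp .seq μ (PMF.pure y)).union ihy).subset ?_
    rintro π (⟨-, μ, hμ, rfl⟩ | ⟨-, h⟩)
    · exact Or.inl ⟨μ, hμ, rfl⟩
    · exact Or.inr h
  | alt x y ihx ihy => exact ihx.union ihy
  | palt p x y ihx ihy =>
    refine ((ihx.union ihy).union (ihx.image2 (convexComb p) ihy)).subset ?_
    rintro π (⟨h, -⟩ | ⟨-, h⟩ | ⟨μ, ν, hμ, hν, rfl⟩)
    · exact Or.inl (Or.inl h)
    · exact Or.inl (Or.inr h)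
    · exact Or.inr ⟨μ, hμ, ν, hν, rfl⟩
  | sync x y ihx ihy =>
    refine ((ihx.image2 (liftOp .sync) ihy).insert (PMF.pure .nil)).subset ?_
    rintro π (⟨-, μ, ν, hμ, hν, rfl⟩ | ⟨-, -, -, rfl⟩)
    · exact Or.inr ⟨μ, hμ, ν, hν, rfl⟩
    · exact Or.inl rfl
  | async x y ihx ihy =>
    have hfin := ((ihx.insert (PMF.pure x)).image2 (liftOp .async) (ihy.insert (PMF.pure y)))
    refine (hfin.insert (PMF.pure .nil)).subset ?_
    rintro π (⟨-, μ, hμ, rfl⟩ | ⟨-, ν, hν, rfl⟩ | ⟨-, -, -, rfl⟩)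
    · exact Or.inr ⟨μ, Or.inr hμ, _, Or.inl rfl, rfl⟩
    · exact Or.inr ⟨_, Or.inl rfl, ν, Or.inr hν, rfl⟩
    · exact Or.inl rfl
  | pasync p x y ihx ihy => exact finite_step_pasync p ihx ihy
  | csp B x y ihx ihy =>
    have hfin := ((ihx.insert (PMF.pure x)).image2 (liftOp (.csp B)) (ihy.insert (PMF.pure y)))
    refine (hfin.insert (PMF.pure .nil)).subset ?_
    rintro π (⟨-, μ, ν, hμ, hν, rfl⟩ | ⟨-, -, -, rfl⟩ | ⟨-, μ, hμ, rfl⟩ | ⟨-, ν, hν, rfl⟩)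
    · exact Or.inr ⟨μ, Or.inr hμ, ν, Or.inr hν, rfl⟩
    · exact Or.inl rfl
    · exact Or.inr ⟨μ, Or.inr hμ, _, Or.inl rfl, rfl⟩
    · exact Or.inr ⟨_, Or.inl rfl, ν, Or.inr hν, rfl⟩

section ProcDist

variable {A : Type*} {tick : A} {lam : ℝ}

theorem isBisimMetric_procDist (hlam : 0 ≤ lam) :
    IsBisimMetric (Step tick) lam (procDist tick lam) :=
  (isLeast_bisimDist hlam (finite_step tick)).1

theorem isBoundedPseudometric_procDist (hlam : 0 ≤ lam) :
    IsBoundedPseudometric (procDist tick lam) :=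
  (isBisimMetric_procDist hlam).isBoundedPseudometric

theorem procDist_le_stepDist (hlam : 0 ≤ lam) (x y : Proc A) :
    procDist tick lam x y ≤ stepDist (Step tick) lam (procDist tick lam) x y :=
  bisimDist_le_stepDist hlam (finite_step tick) x y

theorem procDist_le_of_simulates (hlam : 0 ≤ lam) {x y : Proc A} {c : ℝ} (hc : 0 ≤ c)
    (hxy : Simulates (Step tick) lam (procDist tick lam) c x y)
    (hyx : Simulates (Step tick) lam (procDist tick lam) c y x) : procDist tick lam x y ≤ c :=
  (procDist_le_stepDist hlam x y).trans (stepDist_le_of_simulates hc hxy hyx)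

theorem procDist_eq_zero_of_not_can (hlam : 0 ≤ lam) {x y : Proc A}
    (hx : ∀ a, ¬ Can (Step tick) x a) (hy : ∀ a, ¬ Can (Step tick) y a) :
    procDist tick lam x y = 0 :=
  le_antisymm (procDist_le_of_simulates hlam le_rfl (.of_not_can hx) (.of_not_can hy))
    ((isBoundedPseudometric_procDist hlam).nonneg x y)

theorem procDist_le_of_can_iff (hlam : 0 ≤ lam) {x y : Proc A}
    (h : ∀ a, Can (Step tick) x a ↔ Can (Step tick) y a) : procDist tick lam x y ≤ lam := by
  have hd := isBoundedPseudometric_procDist (tick := tick) hlam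
  have hsim {x y : Proc A} (h : ∀ a, Can (Step tick) x a → Can (Step tick) y a) :
      Simulates (Step tick) lam (procDist tick lam) lam x y := fun a π hπ =>
    (h a ⟨π, hπ⟩).imp fun π' hπ' =>
      ⟨hπ', mul_le_of_le_one_right hlam (kantorovich_mem_Icc hd.mem_Icc π π').2⟩
  exact procDist_le_of_simulates hlam hlam (hsim fun a => (h a).1) (hsim fun a => (h a).2)

theorem nonExtensive_of_simulates (hlam : 0 ≤ lam) {f : Proc A → Proc A → Proc A}
    (hf : ∀ c x y x' y', (∀ a, Can (Step tick) x a ↔ Can (Step tick) x' a) →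
      (∀ a, Can (Step tick) y a ↔ Can (Step tick) y' a) →
      Simulates (Step tick) lam (procDist tick lam) c x x' →
      Simulates (Step tick) lam (procDist tick lam) c y y' →
      Simulates (Step tick) lam (procDist tick lam) c (f x y) (f x' y')) :
    NonExtensive tick lam f := by
  intro x y x' y'
  have hd := isBisimMetric_procDist (tick := tick) hlam
  set c := max (procDist tick lam x x') (procDist tick lam y y')
  rcases lt_or_ge c 1 with hlt | hge
  · obtain ⟨hx, hy⟩ := max_lt_iff.1 hlt
    have hcx := hd.can_iff_of_lt hx
    have hcy := hd.can_iff_of_lt hy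
    refine procDist_le_of_simulates hlam
      (le_max_of_le_left (hd.isBoundedPseudometric.nonneg _ _)) ?_ ?_
    · exact hf c x y x' y' hcx hcy ((hd.simulates hx).mono (le_max_left _ _))
        ((hd.simulates hy).mono (le_max_right _ _))
    · exact hf c x' y' x y (fun a => (hcx a).symm) (fun a => (hcy a).symm)
        ((hd.simulates_symm hx).mono (le_max_left _ _))
        ((hd.simulates_symm hy).mono (le_max_right _ _))
  · exact (hd.isBoundedPseudometric.le_one _ _).trans hge

theorem nonExtensive_alt (hlam : 0 ≤ lam) : NonExtensive tick lam .alt := by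
  refine nonExtensive_of_simulates hlam ?_
  rintro c x y x' y' - - hx hy a π (h | h)
  · exact (hx a π h).imp fun _ => And.imp_left Or.inl
  · exact (hy a π h).imp fun _ => And.imp_left Or.inr

theorem nonExtensive_palt (hlam : 0 ≤ lam) (p : Set.Ioo (0 : ℝ) 1) :
    NonExtensive tick lam (.palt p) := by
  have hd := isBoundedPseudometric_procDist (tick := tick) hlam
  refine nonExtensive_of_simulates hlam ?_
  rintro c x y x' y' hcx hcy hx hy a π (⟨h, hn⟩ | ⟨hn, h⟩ | ⟨μ, ν, hμ, hν, rfl⟩)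
  · exact (hx a π h).imp fun _ => And.imp_left fun h' => Or.inl ⟨h', mt (hcy a).2 hn⟩
  · exact (hy a π h).imp fun _ => And.imp_left fun h' => Or.inr (Or.inl ⟨mt (hcx a).2 hn, h'⟩)
  · obtain ⟨μ', hμ', hμc⟩ := hx a μ hμ
    obtain ⟨ν', hν', hνc⟩ := hy a ν hν
    exact ⟨_, Or.inr (Or.inr ⟨μ', ν', hμ', hν', rfl⟩),
      mul_kantorovich_convexComb_le hd.mem_Icc hlam p hμc hνc⟩

theorem mean_toPMF {m : ℕ} (p : Weights m) (g : Fin m → ℝ) :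
    mean p.toPMF g = ∑ k, p.w k * g k := by
  rw [mean_eq_sum]
  refine Finset.sum_congr rfl fun k _ => ?_
  rw [Weights.toPMF, PMF.ofFintype_apply, ENNReal.toReal_ofReal (p.pos k).le, mul_comm]

theorem procDist_pre_le (hlam : 0 ≤ lam) (a : A) {m : ℕ} (p : Weights m) (s t : Fin m → Proc A) :
    procDist tick lam (.pre a p s) (.pre a p t) ≤
      lam * ∑ k, p.w k * procDist tick lam (s k) (t k) := by
  have hd := isBoundedPseudometric_procDist (tick := tick) hlam
  have hsim (s t : Fin m → Proc A) : Simulates (Step tick) lam (procDist tick lam)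
      (lam * ∑ k, p.w k * procDist tick lam (s k) (t k)) (.pre a p s) (.pre a p t) := by
    rintro _ _ ⟨rfl, rfl⟩
    refine ⟨_, ⟨rfl, rfl⟩, mul_le_mul_of_nonneg_left ?_ hlam⟩
    rw [← PMF.bind_pure_comp, ← PMF.bind_pure_comp, ← mean_toPMF]
    simpa only [Function.comp_apply, kantorovich_pure_pure hd.mem_Icc] using
      kantorovich_bind_le hd.mem_Icc p.toPMF (PMF.pure ∘ s) (PMF.pure ∘ t)
  have hts := hsim t s
  simp only [hd.symm (t _) (s _)] at hts
  exact procDist_le_of_simulates hlam (mul_nonneg hlam (Finset.sum_nonneg fun k _ =>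
    mul_nonneg (p.pos k).le (hd.nonneg _ _))) (hsim s t) hts

theorem le_procDist_pre (hlam : lam ∈ Set.Icc (0 : ℝ) 1) (a : A) {m : ℕ} (p : Weights m)
    {ε : Fin m → ℝ} {s t : Fin m → Proc A} (h : ∀ k l, ε k ≤ procDist tick lam (s k) (t l)) :
    lam * ∑ k, p.w k * ε k ≤ procDist tick lam (.pre a p s) (.pre a p t) := by
  have hd := isBisimMetric_procDist (tick := tick) hlam.1
  have hdb := hd.isBoundedPseudometric
  obtain ⟨k₀, -⟩ := p.toPMF.support_nonempty
  have : Nonempty (Fin m) := ⟨k₀⟩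
  let g (x : Proc A) : ℝ := ⨅ l, procDist tick lam x (t l)
  have hg_le (x : Proc A) (l : Fin m) : g x ≤ procDist tick lam x (t l) :=
    ciInf_le (Set.finite_range _).bddBelow l
  have hg (x : Proc A) : g x ∈ Set.Icc (0 : ℝ) 1 :=
    ⟨le_ciInf fun l => hdb.nonneg x (t l), (hg_le x k₀).trans (hdb.le_one x _)⟩
  calc lam * ∑ k, p.w k * ε k ≤ lam * mean (p.toPMF.map s) g := by
        rw [mean_map _ _ hg, mean_toPMF]
        exact mul_le_mul_of_nonneg_left (Finset.sum_le_sum fun k _ =>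
          mul_le_mul_of_nonneg_left (le_ciInf (h k)) (p.pos k).le) hlam.1
    _ ≤ lam * kantorovich (procDist tick lam) (p.toPMF.map s) (p.toPMF.map t) := by
        refine mul_le_mul_of_nonneg_left (mean_le_kantorovich hdb.mem_Icc hg ?_) hlam.1
        intro x _ y hy
        obtain ⟨l, -, rfl⟩ := (PMF.mem_support_map_iff _ _ _).1 hy
        exact hg_le x l
    _ ≤ procDist tick lam (.pre a p s) (.pre a p t) :=
        hd.mul_kantorovich_le hlam.2 ⟨rfl, rfl⟩ fun _ h => h.2

end ProcDist

section Parallel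

variable {A : Type*} {tick : A} {lam c : ℝ} {d : Proc A → Proc A → ℝ} {x x' y y' : Proc A}
  {Q Q₁ Q₂ : PMF (Proc A) → PMF (Proc A) → Prop} {B : Set A} {f : Proc A → Proc A → Proc A}

/-- The transitions of `x` and `x'` other than termination match up to `Q`, and both or none can
terminate. The targets of terminations are irrelevant, since a parallel composition discards
them. -/
structure Matched (tick : A) (Q : PMF (Proc A) → PMF (Proc A) → Prop) (x x' : Proc A) : Prop where
  tick_iff : Can (Step tick) x tick ↔ Can (Step tick) x' tick
  forth : ∀ a, a ≠ tick → ∀ μ, Step tick x a μ → ∃ μ', Step tick x' a μ' ∧ Q μ μ'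
  back : ∀ a, a ≠ tick → ∀ μ', Step tick x' a μ' → ∃ μ, Step tick x a μ ∧ Q μ μ'

theorem Matched.symm (h : Matched tick Q x x') : Matched tick (fun μ μ' => Q μ' μ) x' x :=
  ⟨h.tick_iff.symm, h.back, h.forth⟩

theorem Matched.can_iff (h : Matched tick Q x x') (a : A) :
    Can (Step tick) x a ↔ Can (Step tick) x' a := by
  rcases eq_or_ne a tick with rfl | ha
  · exact h.tick_iff
  · exact ⟨fun ⟨μ, hμ⟩ => (h.forth a ha μ hμ).imp fun _ => And.left,
      fun ⟨μ, hμ⟩ => (h.back a ha μ hμ).imp fun _ => And.left⟩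

theorem IsBisimMetric.matched (hd : IsBisimMetric (Step tick) lam d) (h : d x x' < 1) :
    Matched tick (fun μ μ' => lam * kantorovich d μ μ' ≤ d x x') x x' where
  tick_iff := hd.can_iff_of_lt h tick
  forth a _ μ hμ := hd.simulates h a μ hμ
  back a _ μ' hμ' := by
    obtain ⟨μ, hμ, hle⟩ := hd.simulates_symm h a μ' hμ'
    exact ⟨μ, hμ, kantorovich_comm hd.isBoundedPseudometric μ μ' ▸ hle⟩

/-- `f` is a parallel composition: actions in `B` are performed synchronously, the other ones
asynchronously, where an action of both components is scheduled nondeterministically or with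
fixed probabilities, and both components have to terminate together. This covers the four parallel
operators of the process algebra. -/
structure ParallelOp (tick : A) (B : Set A) (f : Proc A → Proc A → Proc A) : Prop where
  tick_iff : ∀ x y π, Step tick (f x y) tick π ↔
    Can (Step tick) x tick ∧ Can (Step tick) y tick ∧ π = PMF.pure .nil
  sync_iff : ∀ x y a π, a ≠ tick → a ∈ B → (Step tick (f x y) a π ↔
    ∃ μ ν, Step tick x a μ ∧ Step tick y a ν ∧ π = liftOp f μ ν)
  left_iff : ∀ x y a π, a ≠ tick → a ∉ B → ¬ Can (Step tick) y a → (Step tick (f x y) a π ↔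
    ∃ μ, Step tick x a μ ∧ π = liftOp f μ (PMF.pure y))
  right_iff : ∀ x y a π, a ≠ tick → a ∉ B → ¬ Can (Step tick) x a → (Step tick (f x y) a π ↔
    ∃ ν, Step tick y a ν ∧ π = liftOp f (PMF.pure x) ν)
  both_iff : (∀ x y a π, a ≠ tick → a ∉ B → Can (Step tick) x a → Can (Step tick) y a →
      (Step tick (f x y) a π ↔ (∃ μ, Step tick x a μ ∧ π = liftOp f μ (PMF.pure y)) ∨
        ∃ ν, Step tick y a ν ∧ π = liftOp f (PMF.pure x) ν)) ∨
    ∃ p, ∀ x y a π, a ≠ tick → a ∉ B → Can (Step tick) x a → Can (Step tick) y a →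
      (Step tick (f x y) a π ↔ ∃ μ ν, Step tick x a μ ∧ Step tick y a ν ∧
        π = convexComb p (liftOp f μ (PMF.pure y)) (liftOp f (PMF.pure x) ν))

theorem parallelOp_sync (tick : A) : ParallelOp tick Set.univ .sync where
  tick_iff x y π := by simp [Step, Can]
  sync_iff x y a π ha _ := by simp [Step, ha]
  left_iff x y a π _ h := (h trivial).elim
  right_iff x y a π _ h := (h trivial).elim
  both_iff := Or.inl fun x y a π _ h => (h trivial).elim

theorem parallelOp_async (tick : A) : ParallelOp tick ∅ .async where
  tick_iff x y π := by simp [Step, Can]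
  sync_iff x y a π _ h := h.elim
  left_iff x y a π ha _ h := by simp [Step, ha, not_exists.1 h]
  right_iff x y a π ha _ h := by simp [Step, ha, not_exists.1 h]
  both_iff := Or.inl fun x y a π ha _ _ _ => by simp [Step, ha]

theorem parallelOp_csp (tick : A) (B : Set A) : ParallelOp tick B (.csp B) where
  tick_iff x y π := by simp [Step, Can]
  sync_iff x y a π ha h := by simp [Step, ha, h]
  left_iff x y a π ha hB h := by simp [Step, ha, hB, not_exists.1 h]
  right_iff x y a π ha hB h := by simp [Step, ha, hB, not_exists.1 h]
  both_iff := Or.inl fun x y a π ha hB _ _ => by simp [Step, ha, hB]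

theorem parallelOp_pasync (tick : A) (p : Set.Ioo (0 : ℝ) 1) :
    ParallelOp tick ∅ (.pasync p) where
  tick_iff x y π := by simp [Step, Can]
  sync_iff x y a π _ h := h.elim
  left_iff x y a π ha _ h := by simp [Step, ha, not_exists.1 h]
  right_iff x y a π ha _ h := by simp [Step, ha, not_exists.1 h]
  both_iff := Or.inr ⟨p, fun x y a π ha _ hx hy => by
    simp only [Can] at hx hy
    simp only [Step, hx, hy]
    simp [ha]⟩

namespace ParallelOp

theorem swap (hf : ParallelOp tick B f) : ParallelOp tick B fun x y => f y x where
  tick_iff x y π := by rw [hf.tick_iff, and_left_comm]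
  sync_iff x y a π ha hB := by
    rw [hf.sync_iff _ _ _ _ ha hB, exists_comm]
    simp only [liftOp_swap, and_left_comm]
  left_iff x y a π ha hB h := by
    rw [hf.right_iff _ _ _ _ ha hB h]
    simp only [liftOp_swap]
  right_iff x y a π ha hB h := by
    rw [hf.left_iff _ _ _ _ ha hB h]
    simp only [liftOp_swap]
  both_iff := by
    rcases hf.both_iff with h | ⟨p, h⟩
    · refine Or.inl fun x y a π ha hB hx hy => ?_
      rw [h _ _ _ _ ha hB hy hx, or_comm]
      simp only [liftOp_swap]
    · refine Or.inr ⟨⟨1 - p, sub_pos.2 p.2.2, sub_lt_self 1 p.2.1⟩,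
        fun x y a π ha hB hx hy => ?_⟩
      rw [h _ _ _ _ ha hB hy hx, exists_comm]
      simp only [liftOp_swap, convexComb_symm p, and_left_comm]

theorem can_tick_iff (hf : ParallelOp tick B f) :
    Can (Step tick) (f x y) tick ↔ Can (Step tick) x tick ∧ Can (Step tick) y tick :=
  ⟨fun ⟨_, h⟩ => ((hf.tick_iff x y _).1 h).imp_right And.left,
    fun h => ⟨_, (hf.tick_iff x y _).2 ⟨h.1, h.2, rfl⟩⟩⟩

theorem can_sync_iff (hf : ParallelOp tick B f) {a : A} (ha : a ≠ tick) (hB : a ∈ B) :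
    Can (Step tick) (f x y) a ↔ Can (Step tick) x a ∧ Can (Step tick) y a := by
  constructor
  · rintro ⟨π, h⟩
    obtain ⟨μ, ν, hμ, hν, -⟩ := (hf.sync_iff x y a π ha hB).1 h
    exact ⟨⟨μ, hμ⟩, ⟨ν, hν⟩⟩
  · rintro ⟨⟨μ, hμ⟩, ⟨ν, hν⟩⟩
    exact ⟨_, (hf.sync_iff x y a _ ha hB).2 ⟨μ, ν, hμ, hν, rfl⟩⟩

theorem can_async_iff (hf : ParallelOp tick B f) {a : A} (ha : a ≠ tick) (hB : a ∉ B) :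
    Can (Step tick) (f x y) a ↔ Can (Step tick) x a ∨ Can (Step tick) y a := by
  by_cases hx : Can (Step tick) x a
  · obtain ⟨μ, hμ⟩ := hx
    refine iff_of_true ?_ (Or.inl ⟨μ, hμ⟩)
    by_cases hy : Can (Step tick) y a
    · obtain ⟨ν, hν⟩ := hy
      rcases hf.both_iff with h | ⟨p, h⟩
      · exact ⟨_, (h x y a _ ha hB ⟨μ, hμ⟩ ⟨ν, hν⟩).2 (Or.inl ⟨μ, hμ, rfl⟩)⟩
      · exact ⟨_, (h x y a _ ha hB ⟨μ, hμ⟩ ⟨ν, hν⟩).2 ⟨μ, ν, hμ, hν, rfl⟩⟩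
    · exact ⟨_, (hf.left_iff x y a _ ha hB hy).2 ⟨μ, hμ, rfl⟩⟩
  · rw [or_iff_right hx]
    constructor
    · rintro ⟨π, h⟩
      obtain ⟨ν, hν, -⟩ := (hf.right_iff x y a π ha hB hx).1 h
      exact ⟨ν, hν⟩
    · rintro ⟨ν, hν⟩
      exact ⟨_, (hf.right_iff x y a _ ha hB hx).2 ⟨ν, hν, rfl⟩⟩

theorem exists_async_step (hlam : 0 ≤ lam) (hd : IsBoundedPseudometric d)
    (hf : ParallelOp tick B f) (hx : Matched tick Q₁ x x') (hy : Matched tick Q₂ y y')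
    (hl : ∀ μ μ', Q₁ μ μ' →
      lam * kantorovich d (liftOp f μ (PMF.pure y)) (liftOp f μ' (PMF.pure y')) ≤ c)
    (hr : ∀ ν ν', Q₂ ν ν' →
      lam * kantorovich d (liftOp f (PMF.pure x) ν) (liftOp f (PMF.pure x') ν') ≤ c)
    {a : A} (ha : a ≠ tick) (hB : a ∉ B) {π : PMF (Proc A)} (hπ : Step tick (f x y) a π) :
    ∃ π', Step tick (f x' y') a π' ∧ lam * kantorovich d π π' ≤ c := by
  by_cases hya : Can (Step tick) y a
  · have hya' := (hy.can_iff a).1 hya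
    by_cases hxa : Can (Step tick) x a
    · have hxa' := (hx.can_iff a).1 hxa
      rcases hf.both_iff with h | ⟨p, h⟩
      · rcases (h x y a π ha hB hxa hya).1 hπ with ⟨μ, hμ, rfl⟩ | ⟨ν, hν, rfl⟩
        · obtain ⟨μ', hμ', hQ⟩ := hx.forth a ha μ hμ
          exact ⟨_, (h x' y' a _ ha hB hxa' hya').2 (Or.inl ⟨μ', hμ', rfl⟩), hl μ μ' hQ⟩
        · obtain ⟨ν', hν', hQ⟩ := hy.forth a ha ν hν
          exact ⟨_, (h x' y' a _ ha hB hxa' hya').2 (Or.inr ⟨ν', hν', rfl⟩), hr ν ν' hQ⟩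
      · obtain ⟨μ, ν, hμ, hν, rfl⟩ := (h x y a π ha hB hxa hya).1 hπ
        obtain ⟨μ', hμ', hQ₁⟩ := hx.forth a ha μ hμ
        obtain ⟨ν', hν', hQ₂⟩ := hy.forth a ha ν hν
        exact ⟨_, (h x' y' a _ ha hB hxa' hya').2 ⟨μ', ν', hμ', hν', rfl⟩,
          mul_kantorovich_convexComb_le hd.mem_Icc hlam p (hl μ μ' hQ₁) (hr ν ν' hQ₂)⟩
    · obtain ⟨ν, hν, rfl⟩ := (hf.right_iff x y a π ha hB hxa).1 hπ
      obtain ⟨ν', hν', hQ⟩ := hy.forth a ha ν hν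
      exact ⟨_, (hf.right_iff x' y' a _ ha hB (mt (hx.can_iff a).2 hxa)).2 ⟨ν', hν', rfl⟩,
        hr ν ν' hQ⟩
  · obtain ⟨μ, hμ, rfl⟩ := (hf.left_iff x y a π ha hB hya).1 hπ
    obtain ⟨μ', hμ', hQ⟩ := hx.forth a ha μ hμ
    exact ⟨_, (hf.left_iff x' y' a _ ha hB (mt (hy.can_iff a).2 hya)).2 ⟨μ', hμ', rfl⟩,
      hl μ μ' hQ⟩

theorem simulates (hlam : 0 ≤ lam) (hd : IsBoundedPseudometric d) (hf : ParallelOp tick B f)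
    (hx : Matched tick Q₁ x x') (hy : Matched tick Q₂ y y') (hc : 0 ≤ c)
    (hs : (B \ {tick}).Nonempty → ∀ μ μ' ν ν', Q₁ μ μ' → Q₂ ν ν' →
      lam * kantorovich d (liftOp f μ ν) (liftOp f μ' ν') ≤ c)
    (hl : ∀ μ μ', Q₁ μ μ' →
      lam * kantorovich d (liftOp f μ (PMF.pure y)) (liftOp f μ' (PMF.pure y')) ≤ c)
    (hr : ∀ ν ν', Q₂ ν ν' →
      lam * kantorovich d (liftOp f (PMF.pure x) ν) (liftOp f (PMF.pure x') ν') ≤ c) :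
    Simulates (Step tick) lam d c (f x y) (f x' y') := by
  intro a π hπ
  rcases eq_or_ne a tick with rfl | ha
  · obtain ⟨hxt, hyt, rfl⟩ := (hf.tick_iff x y π).1 hπ
    exact ⟨_, (hf.tick_iff x' y' _).2 ⟨hx.tick_iff.1 hxt, hy.tick_iff.1 hyt, rfl⟩,
      by rwa [kantorovich_self hd, mul_zero]⟩
  by_cases hB : a ∈ B
  · obtain ⟨μ, ν, hμ, hν, rfl⟩ := (hf.sync_iff x y a π ha hB).1 hπ
    obtain ⟨μ', hμ', hQ₁⟩ := hx.forth a ha μ hμ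
    obtain ⟨ν', hν', hQ₂⟩ := hy.forth a ha ν hν
    exact ⟨_, (hf.sync_iff x' y' a _ ha hB).2 ⟨μ', ν', hμ', hν', rfl⟩,
      hs ⟨a, hB, ha⟩ μ μ' ν ν' hQ₁ hQ₂⟩
  · exact hf.exists_async_step hlam hd hx hy hl hr ha hB hπ

theorem stepDist_le (hlam : 0 ≤ lam) (hd : IsBoundedPseudometric d) (hf : ParallelOp tick B f)
    (hx : Matched tick Q₁ x x') (hy : Matched tick Q₂ y y') (hc : 0 ≤ c)
    (hs : (B \ {tick}).Nonempty → ∀ μ μ' ν ν', Q₁ μ μ' → Q₂ ν ν' →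
      lam * kantorovich d (liftOp f μ ν) (liftOp f μ' ν') ≤ c)
    (hl : ∀ μ μ', Q₁ μ μ' →
      lam * kantorovich d (liftOp f μ (PMF.pure y)) (liftOp f μ' (PMF.pure y')) ≤ c)
    (hr : ∀ ν ν', Q₂ ν ν' →
      lam * kantorovich d (liftOp f (PMF.pure x) ν) (liftOp f (PMF.pure x') ν') ≤ c) :
    stepDist (Step tick) lam d (f x y) (f x' y') ≤ c := by
  refine stepDist_le_of_simulates hc (hf.simulates hlam hd hx hy hc hs hl hr)
    (hf.simulates hlam hd hx.symm hy.symm hc ?_ ?_ ?_)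
  · exact fun hB μ μ' ν ν' h₁ h₂ => kantorovich_comm hd _ _ ▸ hs hB _ _ _ _ h₁ h₂
  · exact fun μ μ' h => kantorovich_comm hd _ _ ▸ hl _ _ h
  · exact fun ν ν' h => kantorovich_comm hd _ _ ▸ hr _ _ h

theorem stepDist_le_add (hlam : lam ∈ Set.Icc (0 : ℝ) 1) (hf : ParallelOp tick B f)
    {e : Proc A → Proc A → ℝ} (he : IsBoundedPseudometric e)
    (hd : IsBisimMetric (Step tick) lam d)
    (h : ∀ x y x' y', e (f x y) (f x' y') ≤ d x x' + d y y') (x y x' y' : Proc A) :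
    stepDist (Step tick) lam e (f x y) (f x' y') ≤ d x x' + d y y' := by
  have hdb := hd.isBoundedPseudometric
  have hx0 := hdb.nonneg x x'
  have hy0 := hdb.nonneg y y'
  rcases le_or_gt 1 (d x x') with hx | hx
  · linarith [stepDist_le_one (tr := Step tick) (lam := lam) (d := e) (x := f x y) (y := f x' y')]
  rcases le_or_gt 1 (d y y') with hy | hy
  · linarith [stepDist_le_one (tr := Step tick) (lam := lam) (d := e) (x := f x y) (y := f x' y')]
  have hlift (μ μ' ν ν' : PMF (Proc A)) :
      lam * kantorovich e (liftOp f μ ν) (liftOp f μ' ν') ≤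
        lam * kantorovich d μ μ' + lam * kantorovich d ν ν' := by
    rw [← mul_add]
    exact mul_le_mul_of_nonneg_left
      (kantorovich_liftOp_le hdb.mem_Icc he.mem_Icc (fun x x' y y' => h x y x' y') _ _ _ _) hlam.1
  refine hf.stepDist_le hlam.1 he (hd.matched hx) (hd.matched hy) (add_nonneg hx0 hy0)
    (fun _ μ μ' ν ν' hμ hν => (hlift μ μ' ν ν').trans (add_le_add hμ hν))
    (fun μ μ' hμ => (hlift _ _ _ _).trans (add_le_add hμ ?_))
    (fun ν ν' hν => (hlift _ _ _ _).trans (add_le_add ?_ hν))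
  · rw [kantorovich_pure_pure hdb.mem_Icc]
    exact mul_le_of_le_one_left hy0 hlam.2
  · rw [kantorovich_pure_pure hdb.mem_Icc]
    exact mul_le_of_le_one_left hx0 hlam.2

theorem procDist_le_add (hlam : lam ∈ Set.Icc (0 : ℝ) 1) (hf : ParallelOp tick B f)
    (x y x' y' : Proc A) :
    procDist tick lam (f x y) (f x' y') ≤ procDist tick lam x x' + procDist tick lam y y' := by
  have hd := isBisimMetric_procDist (tick := tick) hlam.1
  exact bisimDist_le_of_stepDist_le hlam.1 (finite_step tick)
    (I := Proc A × Proc A × Proc A × Proc A)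
    (u := fun i => f i.1 i.2.1) (v := fun i => f i.2.2.1 i.2.2.2)
    (b := fun i => procDist tick lam i.1 i.2.2.1 + procDist tick lam i.2.1 i.2.2.2)
    (fun i => add_nonneg (hd.isBoundedPseudometric.nonneg _ _)
      (hd.isBoundedPseudometric.nonneg _ _))
    (fun e he _ h i => hf.stepDist_le_add hlam he hd (fun x y x' y' => h (x, y, x', y')) _ _ _ _)
    (x, y, x', y')

end ParallelOp

end Parallel

section Seq

variable {A : Type*} {tick : A} {lam c : ℝ} {x x' y y' : Proc A}
  {Q : PMF (Proc A) → PMF (Proc A) → Prop}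

theorem can_seq_iff {a : A} : Can (Step tick) (.seq x y) a ↔
    (a ≠ tick ∧ Can (Step tick) x a) ∨ (Can (Step tick) x tick ∧ Can (Step tick) y a) := by
  constructor
  · rintro ⟨π, ⟨ha, μ, hμ, -⟩ | ⟨hx, hy⟩⟩
    · exact Or.inl ⟨ha, μ, hμ⟩
    · exact Or.inr ⟨hx, π, hy⟩
  · rintro (⟨ha, μ, hμ⟩ | ⟨hx, π, hy⟩)
    · exact ⟨_, Or.inl ⟨ha, μ, hμ, rfl⟩⟩
    · exact ⟨π, Or.inr ⟨hx, hy⟩⟩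

theorem simulates_seq {d : Proc A → Proc A → ℝ} (hx : Matched tick Q x x')
    (hy : Simulates (Step tick) lam d c y y')
    (hl : ∀ μ μ', Q μ μ' →
      lam * kantorovich d (liftOp .seq μ (PMF.pure y)) (liftOp .seq μ' (PMF.pure y')) ≤ c) :
    Simulates (Step tick) lam d c (.seq x y) (.seq x' y') := by
  rintro a π (⟨ha, μ, hμ, rfl⟩ | ⟨hxt, hπ⟩)
  · obtain ⟨μ', hμ', hQ⟩ := hx.forth a ha μ hμ
    exact ⟨_, Or.inl ⟨ha, μ', hμ', rfl⟩, hl μ μ' hQ⟩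
  · obtain ⟨π', hπ', hle⟩ := hy a π hπ
    exact ⟨π', Or.inr ⟨hx.tick_iff.1 hxt, hπ'⟩, hle⟩

theorem procDist_seq_le (hlam : 0 ≤ lam) (hx : Matched tick Q x x')
    (hy : procDist tick lam y y' ≤ c)
    (hl : ∀ μ μ', Q μ μ' → lam * kantorovich (procDist tick lam)
      (liftOp .seq μ (PMF.pure y)) (liftOp .seq μ' (PMF.pure y')) ≤ c) :
    procDist tick lam (.seq x y) (.seq x' y') ≤ c := by
  have hd := isBisimMetric_procDist (tick := tick) hlam
  have hdb := hd.isBoundedPseudometric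
  rcases lt_or_ge (procDist tick lam y y') 1 with hlt | hge
  · exact procDist_le_of_simulates hlam ((hdb.nonneg y y').trans hy)
      (simulates_seq hx ((hd.simulates hlt).mono hy) hl)
      (simulates_seq hx.symm ((hd.simulates_symm hlt).mono hy) fun μ μ' h =>
        kantorovich_comm hdb _ _ ▸ hl μ' μ h)
  · exact (hdb.le_one _ _).trans (hge.trans hy)

end Seq

section OneSided

variable {A : Type*} {tick a : A} {x y : Proc A} {π : PMF (Proc A)}

theorem step_alt_left_iff (hy : ¬ Can (Step tick) y a) :
    Step tick (.alt x y) a π ↔ Step tick x a π :=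
  or_iff_left fun h => hy ⟨π, h⟩

theorem step_alt_right_iff (hx : ¬ Can (Step tick) x a) :
    Step tick (.alt x y) a π ↔ Step tick y a π :=
  or_iff_right fun h => hx ⟨π, h⟩

theorem step_palt_left_iff {p : Set.Ioo (0 : ℝ) 1} (hy : ¬ Can (Step tick) y a) :
    Step tick (.palt p x y) a π ↔ Step tick x a π := by
  refine ⟨?_, fun h => Or.inl ⟨h, hy⟩⟩
  rintro (⟨h, -⟩ | ⟨-, h⟩ | ⟨_, ν, -, h, -⟩)
  exacts [h, (hy ⟨π, h⟩).elim, (hy ⟨ν, h⟩).elim]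

theorem step_palt_right_iff {p : Set.Ioo (0 : ℝ) 1} (hx : ¬ Can (Step tick) x a) :
    Step tick (.palt p x y) a π ↔ Step tick y a π := by
  refine ⟨?_, fun h => Or.inr (Or.inl ⟨hx, h⟩)⟩
  rintro (⟨h, -⟩ | ⟨-, h⟩ | ⟨μ, _, h, -, -⟩)
  exacts [(hx ⟨π, h⟩).elim, h, (hx ⟨μ, h⟩).elim]

theorem step_seq_right_iff (hx : ¬ Can (Step tick) x a) (hxt : Can (Step tick) x tick) :
    Step tick (.seq x y) a π ↔ Step tick y a π := by
  refine ⟨?_, fun h => Or.inr ⟨hxt, h⟩⟩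
  rintro (⟨-, μ, hμ, -⟩ | ⟨-, h⟩)
  exacts [(hx ⟨μ, hμ⟩).elim, h]

theorem can_alt_iff : Can (Step tick) (.alt x y) a ↔ Can (Step tick) x a ∨ Can (Step tick) y a :=
  exists_or

theorem can_palt_iff {p : Set.Ioo (0 : ℝ) 1} :
    Can (Step tick) (.palt p x y) a ↔ Can (Step tick) x a ∨ Can (Step tick) y a := by
  by_cases hx : Can (Step tick) x a
  · refine iff_of_true ?_ (Or.inl hx)
    obtain ⟨μ, hμ⟩ := hx
    by_cases hy : Can (Step tick) y a
    · obtain ⟨ν, hν⟩ := hy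
      exact ⟨_, Or.inr (Or.inr ⟨μ, ν, hμ, hν, rfl⟩)⟩
    · exact ⟨μ, (step_palt_left_iff hy).2 hμ⟩
  · rw [or_iff_right hx]
    exact exists_congr fun _ => step_palt_right_iff hx

end OneSided

section HasSteps

variable {A : Type*} {tick a : A} {lam : ℝ} {τ : Prop} {I : Set A} {π₀ π₀' : PMF (Proc A)}
  {x x' : Proc A}

/-- `x` has exactly one transition to `π₀` for each action in `I`, and in addition a termination
transition if `τ` holds. -/
def HasSteps (tick : A) (τ : Prop) (I : Set A) (π₀ : PMF (Proc A)) (x : Proc A) : Prop :=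
  ∀ a π, Step tick x a π ↔ (τ ∧ a = tick ∧ π = PMF.pure .nil) ∨ (a ∈ I ∧ π = π₀)

namespace HasSteps

theorem can_iff (h : HasSteps tick τ I π₀ x) (a : A) :
    Can (Step tick) x a ↔ (τ ∧ a = tick) ∨ a ∈ I := by
  simp only [Can, h a, exists_or, exists_and_left, exists_eq, and_true]

theorem step (h : HasSteps tick τ I π₀ x) (ha : a ∈ I) : Step tick x a π₀ :=
  (h a _).2 (Or.inr ⟨ha, rfl⟩)

theorem eq_of_step (h : HasSteps tick τ I π₀ x) (ha : a ≠ tick) {π : PMF (Proc A)}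
    (hπ : Step tick x a π) : π = π₀ :=
  (((h a π).1 hπ).resolve_left fun h' => ha h'.2.1).2

theorem matched (h : HasSteps tick τ I π₀ x) (h' : HasSteps tick τ I π₀' x') :
    Matched tick (fun μ μ' => μ = π₀ ∧ μ' = π₀') x x' where
  tick_iff := by rw [h.can_iff, h'.can_iff]
  forth a ha μ hμ := by
    obtain ⟨haI, hμ₀⟩ := ((h a μ).1 hμ).resolve_left fun h => ha h.2.1
    exact ⟨π₀', h'.step haI, hμ₀, rfl⟩
  back a ha μ hμ := by
    obtain ⟨haI, hμ₀⟩ := ((h' a μ).1 hμ).resolve_left fun h => ha h.2.1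
    exact ⟨π₀, h.step haI, rfl, hμ₀⟩

theorem simulates (hlam : 0 ≤ lam) (h : HasSteps tick τ I π₀ x) (h' : HasSteps tick τ I π₀' x') :
    Simulates (Step tick) lam (procDist tick lam) (lam * kantorovich (procDist tick lam) π₀ π₀')
      x x' := by
  have hd := isBoundedPseudometric_procDist (tick := tick) hlam
  intro a π hπ
  rcases (h a π).1 hπ with ⟨hτ, ha, rfl⟩ | ⟨haI, rfl⟩
  · refine ⟨_, (h' a _).2 (Or.inl ⟨hτ, ha, rfl⟩), ?_⟩
    rw [kantorovich_self hd, mul_zero]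
    exact mul_nonneg hlam (kantorovich_mem_Icc hd.mem_Icc _ _).1
  · exact ⟨_, h'.step haI, le_rfl⟩

theorem procDist_eq (hlam : lam ∈ Set.Icc (0 : ℝ) 1) (h : HasSteps tick τ I π₀ x)
    (h' : HasSteps tick τ I π₀' x') (ha : a ∈ I) (hat : a ≠ tick) :
    procDist tick lam x x' = lam * kantorovich (procDist tick lam) π₀ π₀' := by
  have hd := isBisimMetric_procDist (tick := tick) hlam.1
  have hdb := hd.isBoundedPseudometric
  refine le_antisymm (procDist_le_of_simulates hlam.1
    (mul_nonneg hlam.1 (kantorovich_mem_Icc hdb.mem_Icc _ _).1) (h.simulates hlam.1 h') ?_)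
    (hd.mul_kantorovich_le hlam.2 (h.step ha) fun _ => h'.eq_of_step hat)
  rw [kantorovich_comm hdb]
  exact h'.simulates hlam.1 h

end HasSteps

theorem not_can_nil (tick a : A) : ¬ Can (Step tick) (.nil : Proc A) a := fun ⟨_, h⟩ => h

end HasSteps

section Branching

variable {A : Type*} {tick : A}

/-- The weight `1` on a single branch. -/
def Weights.single : Weights 1 := ⟨fun _ => 1, fun _ => one_pos, by simp⟩

/-- The weights `1 - q` and `q` on two branches. -/
def Weights.pair (q : Set.Ioo (0 : ℝ) 1) : Weights 2 where
  w := ![1 - q, q]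
  pos i := by
    fin_cases i
    exacts [sub_pos.2 q.2.2, q.2.1]
  sum_eq_one := by simp

theorem toPMF_single_map (x : Proc A) : (Weights.single.toPMF.map fun _ => x) = PMF.pure x :=
  PMF.map_const _ x

theorem toPMF_pair_map (q : Set.Ioo (0 : ℝ) 1) (x y : Proc A) :
    (Weights.pair q).toPMF.map ![x, y] = mix ⟨q, Set.Ioo_subset_Icc_self q.2⟩ x y := by
  ext z
  rw [mix, PMF.map_apply, PMF.map_apply, tsum_fintype, tsum_fintype, Fin.sum_univ_two,
    Fintype.sum_bool, add_comm]
  rfl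

/-- The process `a.x`. -/
def Proc.act (a : A) (x : Proc A) : Proc A := .pre a .single fun _ => x

/-- The process `ε` if `i` is true, and `0` otherwise. -/
def Proc.opt (i : Bool) : Proc A := cond i .skip .nil

open Classical in
/-- The process `a.([1 - q]x ⊕ [q]y)`; since the weights of a prefix are positive, branches of
probability `0` are left out. -/
def Proc.branch (a : A) (q : Set.Icc (0 : ℝ) 1) (x y : Proc A) : Proc A :=
  if h0 : (q : ℝ) = 0 then .act a x
  else if h1 : (q : ℝ) = 1 then .act a y
  else .pre a (.pair ⟨q, lt_of_le_of_ne' q.2.1 h0, lt_of_le_of_ne q.2.2 h1⟩) ![x, y]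

theorem step_act_iff (a : A) (x : Proc A) (c : A) (π : PMF (Proc A)) :
    Step tick (.act a x) c π ↔ c = a ∧ π = PMF.pure x := by
  simp only [Proc.act, Step, toPMF_single_map]

theorem hasSteps_act (tick a : A) (x : Proc A) :
    HasSteps tick False {a} (PMF.pure x) (.act a x) := fun c π => by
  rw [step_act_iff, false_and, false_or, Set.mem_singleton_iff]

theorem hasSteps_seq_act {a : A} (ha : a ≠ tick) (x y : Proc A) :
    HasSteps tick False {a} (PMF.pure (.seq x y)) (.seq (.act a x) y) := by
  intro c π
  have htick : ¬ Can (Step tick) (.act a x) tick := by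
    simpa [(hasSteps_act tick a x).can_iff] using ha.symm
  rw [false_and, false_or, Set.mem_singleton_iff]
  constructor
  · rintro (⟨-, μ, hμ, rfl⟩ | ⟨h, -⟩)
    · obtain ⟨rfl, rfl⟩ := (step_act_iff a x c μ).1 hμ
      exact ⟨rfl, liftOp_pure_pure _ _ _⟩
    · exact (htick h).elim
  · rintro ⟨rfl, rfl⟩
    exact Or.inl ⟨ha, _, (step_act_iff c x c _).2 ⟨rfl, rfl⟩, (liftOp_pure_pure _ _ _).symm⟩

theorem procDist_seq_act_nil {a : A} {lam : ℝ} (hlam : lam ∈ Set.Icc (0 : ℝ) 1) (ha : a ≠ tick)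
    (y y' : Proc A) :
    procDist tick lam (.seq (.act a .nil) y) (.seq (.act a .nil) y') = 0 := by
  have hnil (y : Proc A) (c : A) : ¬ Can (Step tick) (.seq .nil y) c := fun h =>
    (can_seq_iff.1 h).elim (fun h => not_can_nil tick c h.2) fun h => not_can_nil tick tick h.1
  rw [(hasSteps_seq_act ha _ _).procDist_eq hlam (hasSteps_seq_act ha _ _) rfl ha,
    kantorovich_pure_pure (isBoundedPseudometric_procDist hlam.1).mem_Icc,
    procDist_eq_zero_of_not_can hlam.1 (hnil y) (hnil y'), mul_zero]

theorem step_opt_iff (i : Bool) (c : A) (π : PMF (Proc A)) :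
    Step tick (.opt i) c π ↔ i = true ∧ c = tick ∧ π = PMF.pure .nil := by
  cases i <;> simp [Proc.opt, Step]

theorem step_branch_iff (a : A) (q : Set.Icc (0 : ℝ) 1) (x y : Proc A) (c : A)
    (π : PMF (Proc A)) : Step tick (.branch a q x y) c π ↔ c = a ∧ π = mix q x y := by
  obtain ⟨q, hq⟩ := q
  rw [Proc.branch]
  split_ifs with h0 h1
  · obtain rfl : q = 0 := h0
    rw [step_act_iff, mix_zero]
  · obtain rfl : q = 1 := h1
    rw [step_act_iff, mix_one]
  · simp only [Step, toPMF_pair_map]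

end Branching

/-- The actions of the test processes, besides termination: all test processes perform `common`,
the two sides of a binary operator are told apart by `label true` and `label false`, and `fresh`
is performed only once the other actions are used up. -/
structure TestActions {A : Type*} (tick : A) where
  common : A
  fresh : A
  label : Bool → A
  nodup : [tick, common, fresh, label true, label false].Nodup

namespace TestActions

variable {A : Type*} {tick : A} {lam : ℝ} {B : Set A} {f : Proc A → Proc A → Proc A}
  (L : TestActions tick) {i j : Bool}

/-- The initial actions of the test processes with index `i`. -/
def actions (i : Bool) : Set A := {L.common, L.label i}

/-- The actions of the gates that the test processes pass after their first step. -/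
def offered : Set A := {L.common, L.label true, L.label false}

theorem common_mem_actions (i : Bool) : L.common ∈ L.actions i := Or.inl rfl

theorem label_mem_actions (i : Bool) : L.label i ∈ L.actions i := Or.inr rfl

theorem common_mem_offered : L.common ∈ L.offered := Or.inl rfl

theorem label_mem_offered (i : Bool) : L.label i ∈ L.offered := by
  cases i <;> simp [offered]

theorem actions_subset_offered (i : Bool) : L.actions i ⊆ L.offered := by
  rintro _ (rfl | rfl)
  exacts [L.common_mem_offered, L.label_mem_offered i]

theorem common_ne_tick : L.common ≠ tick := by
  have h := L.nodup
  grind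

theorem fresh_ne_tick : L.fresh ≠ tick := by
  have h := L.nodup
  grind

theorem common_ne_fresh : L.common ≠ L.fresh := by
  have h := L.nodup
  grind

theorem label_ne_tick (i : Bool) : L.label i ≠ tick := by
  have h := L.nodup
  cases i <;> grind

theorem label_notMem_actions (hij : i ≠ j) : L.label i ∉ L.actions j := by
  have h := L.nodup
  simp only [actions, Set.mem_insert_iff, Set.mem_singleton_iff]
  cases i <;> cases j <;> grind

theorem tick_notMem_offered : tick ∉ L.offered := by
  have h := L.nodup
  simp only [offered, Set.mem_insert_iff, Set.mem_singleton_iff]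
  grind

theorem fresh_notMem_offered : L.fresh ∉ L.offered := by
  have h := L.nodup
  simp only [offered, Set.mem_insert_iff, Set.mem_singleton_iff]
  grind

/-- The process reached by the test processes with index `i` after their first step, unless they
deadlock. The gate of index `true` can also terminate. -/
def gate (i : Bool) : Proc A :=
  .alt (.opt i) (.alt (.act L.common (.act L.fresh .nil)) (.alt
    (.act (L.label true) (.act L.fresh .nil)) (.act (L.label false) (.act L.fresh .nil))))

/-- The first process of a test pair: its first step leads to a deadlock with probability `q`. The
source of index `true` can also terminate. -/
def source (i : Bool) (q : Set.Icc (0 : ℝ) 1) : Proc A :=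
  .alt (.opt i) (.alt (.branch L.common q (L.gate i) .nil) (.branch (L.label i) q (L.gate i) .nil))

/-- The second process of a test pair, which never deadlocks in its first step. -/
def target (i : Bool) : Proc A := L.source i ⟨0, by simp⟩

theorem hasSteps_gate (i : Bool) :
    HasSteps tick (i = true) L.offered (PMF.pure (.act L.fresh .nil)) (L.gate i) := by
  intro a π
  simp only [gate, offered, Step, step_opt_iff, step_act_iff, Set.mem_insert_iff,
    Set.mem_singleton_iff]
  tauto

theorem hasSteps_source (i : Bool) (q : Set.Icc (0 : ℝ) 1) :
    HasSteps tick (i = true) (L.actions i) (mix q (L.gate i) .nil) (L.source i q) := by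
  intro a π
  simp only [source, actions, Step, step_opt_iff, step_branch_iff, Set.mem_insert_iff,
    Set.mem_singleton_iff]
  tauto

theorem hasSteps_target (i : Bool) :
    HasSteps tick (i = true) (L.actions i) (PMF.pure (L.gate i)) (L.target i) := by
  have h := L.hasSteps_source i ⟨0, by simp⟩
  rwa [mix_zero] at h

theorem not_can_source {a : A} (hat : a ≠ tick) (ha : a ∉ L.actions i) (q : Set.Icc (0 : ℝ) 1) :
    ¬ Can (Step tick) (L.source i q) a := by
  rw [(L.hasSteps_source i q).can_iff]
  exact not_or.2 ⟨fun h => hat h.2, ha⟩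

theorem not_can_source_label (hij : i ≠ j) (q : Set.Icc (0 : ℝ) 1) :
    ¬ Can (Step tick) (L.source j q) (L.label i) :=
  L.not_can_source (L.label_ne_tick i) (L.label_notMem_actions hij) q

theorem not_can_target_label (hij : i ≠ j) : ¬ Can (Step tick) (L.target j) (L.label i) :=
  L.not_can_source_label hij _

theorem not_can_target_fresh (i : Bool) : ¬ Can (Step tick) (L.target i) L.fresh :=
  L.not_can_source L.fresh_ne_tick (fun h => L.fresh_notMem_offered
    (L.actions_subset_offered i h)) _

theorem can_gate {a : A} (ha : a ∈ L.offered) (i : Bool) : Can (Step tick) (L.gate i) a :=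
  ⟨_, (L.hasSteps_gate i).step ha⟩

theorem not_can_gate_fresh (i : Bool) : ¬ Can (Step tick) (L.gate i) L.fresh := by
  rw [(L.hasSteps_gate i).can_iff]
  exact not_or.2 ⟨fun h => L.fresh_ne_tick h.2, L.fresh_notMem_offered⟩

theorem procDist_nil_gate (hlam : 0 ≤ lam) (i : Bool) : procDist tick lam .nil (L.gate i) = 1 :=
  (isBisimMetric_procDist hlam).eq_one_of_can_right (not_can_nil tick L.common)
    (L.can_gate L.common_mem_offered i)

theorem kantorovich_mix_gate (hlam : 0 ≤ lam) (i : Bool) (q : Set.Icc (0 : ℝ) 1) :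
    kantorovich (procDist tick lam) (mix q (L.gate i) .nil) (PMF.pure (L.gate i)) = q := by
  have hd := isBoundedPseudometric_procDist (tick := tick) hlam
  rw [kantorovich_mix_pure hd.mem_Icc, hd.self, L.procDist_nil_gate hlam, mul_zero, mul_one,
    zero_add]

theorem procDist_source_target (hlam : lam ∈ Set.Icc (0 : ℝ) 1) (i : Bool)
    (q : Set.Icc (0 : ℝ) 1) : procDist tick lam (L.source i q) (L.target i) = lam * q := by
  rw [(L.hasSteps_source i q).procDist_eq hlam (L.hasSteps_target i) (L.common_mem_actions i)
    L.common_ne_tick, L.kantorovich_mix_gate hlam.1]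

theorem le_procDist_source_target (hlam : lam ∈ Set.Icc (0 : ℝ) 1) (i j : Bool)
    (q : Set.Icc (0 : ℝ) 1) : lam * q ≤ procDist tick lam (L.source i q) (L.target j) := by
  have hd := isBisimMetric_procDist (tick := tick) hlam.1
  have hdb := hd.isBoundedPseudometric
  refine le_trans ?_ (hd.mul_kantorovich_le hlam.2
    ((L.hasSteps_source i q).step (L.common_mem_actions i))
    fun _ => (L.hasSteps_target j).eq_of_step L.common_ne_tick)
  rw [kantorovich_mix_pure hdb.mem_Icc, L.procDist_nil_gate hlam.1, mul_one]
  exact mul_le_mul_of_nonneg_left (le_add_of_nonneg_left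
    (mul_nonneg (sub_nonneg.2 q.2.2) (hdb.nonneg _ _))) hlam.1

theorem le_procDist_of_step_label_iff (hlam : lam ∈ Set.Icc (0 : ℝ) 1) {q : Set.Icc (0 : ℝ) 1}
    {x x' : Proc A}
    (hx : ∀ π, Step tick x (L.label i) π ↔ Step tick (L.source i q) (L.label i) π)
    (hx' : ∀ π, Step tick x' (L.label i) π ↔ Step tick (L.target i) (L.label i) π) :
    lam * q ≤ procDist tick lam x x' := by
  rw [← L.kantorovich_mix_gate hlam.1 i q]
  exact (isBisimMetric_procDist hlam.1).mul_kantorovich_le hlam.2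
    ((hx _).2 ((L.hasSteps_source i q).step (L.label_mem_actions i)))
    fun π h => (L.hasSteps_target i).eq_of_step (L.label_ne_tick i) ((hx' π).1 h)

theorem procDist_alt (hlam : lam ∈ Set.Icc (0 : ℝ) 1) (hij : i ≠ j) (q r : Set.Icc (0 : ℝ) 1) :
    procDist tick lam (.alt (L.source i q) (L.source j r)) (.alt (L.target i) (L.target j)) =
      max (lam * q) (lam * r) := by
  refine le_antisymm ?_ (max_le ?_ ?_)
  · simpa only [L.procDist_source_target hlam] using nonExtensive_alt (tick := tick) hlam.1
      (L.source i q) (L.source j r) (L.target i) (L.target j)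
  · exact L.le_procDist_of_step_label_iff hlam
      (fun _ => step_alt_left_iff (L.not_can_source_label hij r))
      (fun _ => step_alt_left_iff (L.not_can_target_label hij))
  · exact L.le_procDist_of_step_label_iff hlam
      (fun _ => step_alt_right_iff (L.not_can_source_label hij.symm q))
      (fun _ => step_alt_right_iff (L.not_can_target_label hij.symm))

theorem procDist_palt (hlam : lam ∈ Set.Icc (0 : ℝ) 1) (hij : i ≠ j) (p : Set.Ioo (0 : ℝ) 1)
    (q r : Set.Icc (0 : ℝ) 1) :
    procDist tick lam (.palt p (L.source i q) (L.source j r))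
      (.palt p (L.target i) (L.target j)) = max (lam * q) (lam * r) := by
  refine le_antisymm ?_ (max_le ?_ ?_)
  · simpa only [L.procDist_source_target hlam] using nonExtensive_palt (tick := tick) hlam.1 p
      (L.source i q) (L.source j r) (L.target i) (L.target j)
  · exact L.le_procDist_of_step_label_iff hlam
      (fun _ => step_palt_left_iff (L.not_can_source_label hij r))
      (fun _ => step_palt_left_iff (L.not_can_target_label hij))
  · exact L.le_procDist_of_step_label_iff hlam
      (fun _ => step_palt_right_iff (L.not_can_source_label hij.symm q))
      (fun _ => step_palt_right_iff (L.not_can_target_label hij.symm))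

theorem procDist_async_idle (hlam : lam ∈ Set.Icc (0 : ℝ) 1) (hf : ParallelOp tick B f)
    (hB : L.common ∉ B) {z : Proc A} (hz : ¬ Can (Step tick) z L.common) (j : Bool)
    (r : Set.Icc (0 : ℝ) 1) :
    procDist tick lam (f z (L.source j r)) (f z (L.target j)) = lam * r := by
  have hd := isBisimMetric_procDist (tick := tick) hlam.1
  have hdb := hd.isBoundedPseudometric
  have hct := L.common_ne_tick
  refine le_antisymm ?_ ?_
  · simpa only [hdb.self, zero_add, L.procDist_source_target hlam] using
      hf.procDist_le_add hlam z (L.source j r) z (L.target j)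
  · have hnil : procDist tick lam (f z .nil) (f z (L.gate j)) = 1 := hd.eq_one_of_can_right
      (fun h => ((hf.can_async_iff hct hB).1 h).elim hz (not_can_nil tick _))
      ((hf.can_async_iff hct hB).2 (Or.inr (L.can_gate L.common_mem_offered j)))
    have hK : kantorovich (procDist tick lam) (liftOp f (PMF.pure z) (mix r (L.gate j) .nil))
        (liftOp f (PMF.pure z) (PMF.pure (L.gate j))) = r := by
      rw [kantorovich_liftOp_pure_mix hdb.mem_Icc, hdb.self, hnil, mul_zero, zero_add, mul_one]
    rw [← hK]
    refine hd.mul_kantorovich_le hlam.2 ((hf.right_iff _ _ _ _ hct hB hz).2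
      ⟨_, (L.hasSteps_source j r).step (L.common_mem_actions j), rfl⟩) fun π h => ?_
    obtain ⟨ν, hν, rfl⟩ := (hf.right_iff _ _ _ _ hct hB hz).1 h
    rw [(L.hasSteps_target j).eq_of_step hct hν]

theorem procDist_async_nil_le (hlam : 0 ≤ lam) (hf : ParallelOp tick B f) (hB : B ⊆ {tick})
    (hij : i ≠ j) : procDist tick lam (f (L.gate i) .nil) (f (L.gate i) (L.gate j)) ≤ lam := by
  refine procDist_le_of_can_iff hlam fun a => ?_
  have hnil := not_can_nil tick a
  rcases eq_or_ne a tick with rfl | ha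
  · rw [hf.can_tick_iff, hf.can_tick_iff, (L.hasSteps_gate i).can_iff, (L.hasSteps_gate j).can_iff]
    have htick := L.tick_notMem_offered
    cases i <;> cases j <;> simp_all
  · have haB : a ∉ B := fun h => ha (hB h)
    rw [hf.can_async_iff ha haB, hf.can_async_iff ha haB, (L.hasSteps_gate i).can_iff,
      (L.hasSteps_gate j).can_iff]
    tauto

theorem procDist_async_gate (hlam : lam ∈ Set.Icc (0 : ℝ) 1) (hf : ParallelOp tick B f)
    (hB : B ⊆ {tick}) (hij : i ≠ j) (r : Set.Icc (0 : ℝ) 1) :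
    procDist tick lam (f (L.gate i) (L.source j r)) (f (L.gate i) (L.target j)) =
      lam * (lam * r) := by
  have hd := isBisimMetric_procDist (tick := tick) hlam.1
  have hdb := hd.isBoundedPseudometric
  have hidle := L.procDist_async_idle hlam hf (fun h => L.common_ne_tick (hB h))
    (z := .act L.fresh .nil) (by simpa [(hasSteps_act tick _ _).can_iff] using L.common_ne_fresh)
    j r
  refine le_antisymm ((procDist_le_stepDist hlam.1 _ _).trans (hf.stepDist_le hlam.1 hdb
    ((L.hasSteps_gate i).matched (L.hasSteps_gate i))
    ((L.hasSteps_source j r).matched (L.hasSteps_target j))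
    (mul_nonneg hlam.1 (mul_nonneg hlam.1 r.2.1)) ?_ ?_ ?_)) ?_
  · rw [Set.sdiff_eq_empty.2 hB]
    exact fun h => (Set.not_nonempty_empty h).elim
  · rintro _ _ ⟨rfl, rfl⟩
    rw [liftOp_pure_pure, liftOp_pure_pure, kantorovich_pure_pure hdb.mem_Icc, hidle]
  · rintro _ _ ⟨rfl, rfl⟩
    rw [kantorovich_liftOp_pure_mix hdb.mem_Icc, hdb.self, mul_zero, zero_add,
      mul_comm lam (r : ℝ)]
    exact mul_le_mul_of_nonneg_left (mul_le_mul_of_nonneg_left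
      (L.procDist_async_nil_le hlam.1 hf hB hij) r.2.1) hlam.1
  · have hlt := L.label_ne_tick i
    have hlB : L.label i ∉ B := fun h => hlt (hB h)
    have hleft π := hf.left_iff (L.gate i) (L.source j r) _ π hlt hlB
      (L.not_can_source_label hij r)
    have hleft' π := hf.left_iff (L.gate i) (L.target j) _ π hlt hlB (L.not_can_target_label hij)
    rw [← hidle, ← kantorovich_pure_pure hdb.mem_Icc, ← liftOp_pure_pure f, ← liftOp_pure_pure f]
    refine hd.mul_kantorovich_le hlam.2
      ((hleft _).2 ⟨_, (L.hasSteps_gate i).step (L.label_mem_offered i), rfl⟩) fun π h => ?_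
    obtain ⟨μ, hμ, rfl⟩ := (hleft' π).1 h
    rw [(L.hasSteps_gate i).eq_of_step hlt hμ]

theorem kantorovich_async_left (hlam : lam ∈ Set.Icc (0 : ℝ) 1) (hf : ParallelOp tick B f)
    (hB : B ⊆ {tick}) (hij : i ≠ j) (q r : Set.Icc (0 : ℝ) 1) :
    kantorovich (procDist tick lam)
      (liftOp f (mix q (L.gate i) .nil) (PMF.pure (L.source j r)))
      (liftOp f (PMF.pure (L.gate i)) (PMF.pure (L.target j))) =
      (1 - q) * (lam * (lam * r)) + q := by
  have hd := isBisimMetric_procDist (tick := tick) hlam.1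
  have hlt := L.label_ne_tick i
  have hlB : L.label i ∉ B := fun h => hlt (hB h)
  have hnil : procDist tick lam (f .nil (L.source j r)) (f (L.gate i) (L.target j)) = 1 :=
    hd.eq_one_of_can_right
      (fun h => ((hf.can_async_iff hlt hlB).1 h).elim (not_can_nil tick _)
        (L.not_can_source_label hij r))
      ((hf.can_async_iff hlt hlB).2 (Or.inl (L.can_gate (L.label_mem_offered i) i)))
  rw [kantorovich_liftOp_mix_pure hd.isBoundedPseudometric.mem_Icc,
    L.procDist_async_gate hlam hf hB hij r, hnil, mul_one]

theorem le_procDist_async (hlam : lam ∈ Set.Icc (0 : ℝ) 1) (hf : ParallelOp tick B f)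
    (hB : B ⊆ {tick}) (hij : i ≠ j) (q r : Set.Icc (0 : ℝ) 1) :
    lam * ((1 - q) * (lam * (lam * r)) + q) ≤
      procDist tick lam (f (L.source i q) (L.source j r)) (f (L.target i) (L.target j)) := by
  have hlt := L.label_ne_tick i
  have hlB : L.label i ∉ B := fun h => hlt (hB h)
  have hleft π := hf.left_iff (L.source i q) (L.source j r) _ π hlt hlB
    (L.not_can_source_label hij r)
  have hleft' π := hf.left_iff (L.target i) (L.target j) _ π hlt hlB (L.not_can_target_label hij)
  rw [← L.kantorovich_async_left hlam hf hB hij]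
  refine (isBisimMetric_procDist hlam.1).mul_kantorovich_le hlam.2
    ((hleft _).2 ⟨_, (L.hasSteps_source i q).step (L.label_mem_actions i), rfl⟩) fun π h => ?_
  obtain ⟨μ, hμ, rfl⟩ := (hleft' π).1 h
  rw [(L.hasSteps_target i).eq_of_step hlt hμ]

theorem procDist_async (hlam : lam ∈ Set.Icc (0 : ℝ) 1) (hf : ParallelOp tick B f)
    (hB : B ⊆ {tick}) (hij : i ≠ j) (q r : Set.Icc (0 : ℝ) 1) :
    procDist tick lam (f (L.source i q) (L.source j r)) (f (L.target i) (L.target j)) =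
      max (lam * ((1 - q) * (lam * (lam * r)) + q)) (lam * ((1 - r) * (lam * (lam * q)) + r)) := by
  have hdb := isBoundedPseudometric_procDist (tick := tick) hlam.1
  have hleft := L.kantorovich_async_left hlam hf hB hij q r
  have hright := L.kantorovich_async_left hlam hf.swap hB hij.symm r q
  rw [liftOp_swap f, liftOp_swap f] at hright
  refine le_antisymm ((procDist_le_stepDist hlam.1 _ _).trans (hf.stepDist_le hlam.1 hdb
    ((L.hasSteps_source i q).matched (L.hasSteps_target i))
    ((L.hasSteps_source j r).matched (L.hasSteps_target j)) (le_max_of_le_left ?_) ?_ ?_ ?_))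
    (max_le (L.le_procDist_async hlam hf hB hij q r)
      (L.le_procDist_async hlam hf.swap hB hij.symm r q))
  · rw [← hleft]
    exact mul_nonneg hlam.1 (kantorovich_mem_Icc hdb.mem_Icc _ _).1
  · rw [Set.sdiff_eq_empty.2 hB]
    exact fun h => (Set.not_nonempty_empty h).elim
  · rintro _ _ ⟨rfl, rfl⟩
    exact hleft ▸ le_max_left _ _
  · rintro _ _ ⟨rfl, rfl⟩
    exact hright ▸ le_max_right _ _

theorem kantorovich_sync (hlam : 0 ≤ lam) (hf : ParallelOp tick B f) (hB : L.common ∈ B)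
    (i j : Bool) (q r : Set.Icc (0 : ℝ) 1) :
    kantorovich (procDist tick lam)
      (liftOp f (mix q (L.gate i) .nil) (mix r (L.gate j) .nil))
      (liftOp f (PMF.pure (L.gate i)) (PMF.pure (L.gate j))) = (1 - q) * r + q := by
  have hd := isBisimMetric_procDist (tick := tick) hlam
  have hdb := hd.isBoundedPseudometric
  have hct := L.common_ne_tick
  have hgates : Can (Step tick) (f (L.gate i) (L.gate j)) L.common := (hf.can_sync_iff hct hB).2
    ⟨L.can_gate L.common_mem_offered i, L.can_gate L.common_mem_offered j⟩
  have hl (y : Proc A) : procDist tick lam (f .nil y) (f (L.gate i) (L.gate j)) = 1 :=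
    hd.eq_one_of_can_right (fun h => not_can_nil tick _ ((hf.can_sync_iff hct hB).1 h).1) hgates
  have hr (x : Proc A) : procDist tick lam (f x .nil) (f (L.gate i) (L.gate j)) = 1 :=
    hd.eq_one_of_can_right (fun h => not_can_nil tick _ ((hf.can_sync_iff hct hB).1 h).2) hgates
  rw [liftOp_pure_pure, kantorovich_liftOp_pure_right hdb.mem_Icc,
    mean_mix _ _ _ fun x => mean_mem_Icc _ fun y => hdb.mem_Icc _ _,
    mean_mix _ _ _ fun x => hdb.mem_Icc _ _, mean_mix _ _ _ fun x => hdb.mem_Icc _ _,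
    hdb.self, hl, hl, hr]
  ring

theorem procDist_sync_le (hlam : lam ∈ Set.Icc (0 : ℝ) 1) (hf : ParallelOp tick B f)
    (hB : L.common ∈ B) (i j : Bool) (q r : Set.Icc (0 : ℝ) 1) :
    procDist tick lam (f (L.source i q) (L.source j r)) (f (L.target i) (L.target j)) ≤
      lam * ((1 - q) * r + q) := by
  have hdb := isBoundedPseudometric_procDist (tick := tick) hlam.1
  have hsum : (1 - q : ℝ) * r + q = (1 - r) * q + r := by ring
  have hle (q : Set.Icc (0 : ℝ) 1) : lam * (q : ℝ) ≤ q := mul_le_of_le_one_left q.2.1 hlam.2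
  refine (procDist_le_stepDist hlam.1 _ _).trans (hf.stepDist_le hlam.1 hdb
    ((L.hasSteps_source i q).matched (L.hasSteps_target i))
    ((L.hasSteps_source j r).matched (L.hasSteps_target j)) ?_ ?_ ?_ ?_)
  · exact mul_nonneg hlam.1 (add_nonneg (mul_nonneg (sub_nonneg.2 q.2.2) r.2.1) q.2.1)
  · rintro - _ _ _ _ ⟨rfl, rfl⟩ ⟨rfl, rfl⟩
    rw [L.kantorovich_sync hlam.1 hf hB]
  · rintro _ _ ⟨rfl, rfl⟩
    have hgate := hf.procDist_le_add hlam (L.gate i) (L.source j r) (L.gate i) (L.target j)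
    rw [hdb.self, zero_add, L.procDist_source_target hlam] at hgate
    rw [kantorovich_liftOp_mix_pure hdb.mem_Icc]
    exact mul_le_mul_of_nonneg_left (add_le_add
      (mul_le_mul_of_nonneg_left (hgate.trans (hle r)) (sub_nonneg.2 q.2.2))
      (mul_le_of_le_one_right q.2.1 (hdb.le_one _ _))) hlam.1
  · rintro _ _ ⟨rfl, rfl⟩
    have hgate := hf.procDist_le_add hlam (L.source i q) (L.gate j) (L.target i) (L.gate j)
    rw [hdb.self, add_zero, L.procDist_source_target hlam] at hgate
    rw [kantorovich_liftOp_pure_mix hdb.mem_Icc, hsum]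
    exact mul_le_mul_of_nonneg_left (add_le_add
      (mul_le_mul_of_nonneg_left (hgate.trans (hle q)) (sub_nonneg.2 r.2.2))
      (mul_le_of_le_one_right r.2.1 (hdb.le_one _ _))) hlam.1

theorem procDist_sync (hlam : lam ∈ Set.Icc (0 : ℝ) 1) (hf : ParallelOp tick B f)
    (hB : L.common ∈ B) (i j : Bool) (q r : Set.Icc (0 : ℝ) 1) :
    procDist tick lam (f (L.source i q) (L.source j r)) (f (L.target i) (L.target j)) =
      lam * ((1 - q) * r + q) := by
  refine le_antisymm (L.procDist_sync_le hlam hf hB i j q r) ?_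
  rw [← L.kantorovich_sync hlam.1 hf hB i j]
  refine (isBisimMetric_procDist hlam.1).mul_kantorovich_le hlam.2
    ((hf.sync_iff _ _ L.common _ L.common_ne_tick hB).2 ⟨_, _,
      (L.hasSteps_source i q).step (L.common_mem_actions i),
      (L.hasSteps_source j r).step (L.common_mem_actions j), rfl⟩) fun π h => ?_
  obtain ⟨μ, ν, hμ, hν, rfl⟩ := (hf.sync_iff _ _ _ _ L.common_ne_tick hB).1 h
  rw [(L.hasSteps_target i).eq_of_step L.common_ne_tick hμ,
    (L.hasSteps_target j).eq_of_step L.common_ne_tick hν]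

theorem can_gate_true_tick : Can (Step tick) (L.gate true) tick :=
  ((L.hasSteps_gate true).can_iff tick).2 (Or.inl ⟨rfl, rfl⟩)

theorem can_source_true_tick (q : Set.Icc (0 : ℝ) 1) :
    Can (Step tick) (L.source true q) tick :=
  ((L.hasSteps_source true q).can_iff tick).2 (Or.inl ⟨rfl, rfl⟩)

theorem le_procDist_seq_gate (hlam : lam ∈ Set.Icc (0 : ℝ) 1) (j : Bool)
    (r : Set.Icc (0 : ℝ) 1) :
    lam * r ≤ procDist tick lam (.seq (L.gate true) (L.source j r))
      (.seq (L.gate true) (L.target j)) := by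
  have hd := isBisimMetric_procDist (tick := tick) hlam.1
  have hct := L.common_ne_tick
  have hle : lam * (r : ℝ) ≤ 1 := mul_le_one₀ hlam.2 r.2.1 r.2.2
  have hstep : Step tick (.seq (L.gate true) (L.source j r)) L.common (mix r (L.gate j) .nil) :=
    Or.inr ⟨L.can_gate_true_tick, (L.hasSteps_source j r).step (L.common_mem_actions j)⟩
  refine hd.le_of_forall_le hle hstep ?_
  rintro π (⟨-, μ, hμ, rfl⟩ | ⟨-, h⟩)
  · have hfresh : Can (Step tick) (.seq (.act L.fresh .nil) (L.target j)) L.fresh :=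
      ⟨_, (hasSteps_seq_act L.fresh_ne_tick _ _).step rfl⟩
    rw [(L.hasSteps_gate true).eq_of_step hct hμ, liftOp_pure_pure,
      kantorovich_mix_pure hd.isBoundedPseudometric.mem_Icc,
      hd.eq_one_of_can_right (L.not_can_gate_fresh j) hfresh,
      hd.eq_one_of_can_right (not_can_nil tick _) hfresh, mul_one, mul_one, sub_add_cancel]
    exact mul_le_mul_of_nonneg_left r.2.2 hlam.1
  · rw [(L.hasSteps_target j).eq_of_step hct h, L.kantorovich_mix_gate hlam.1]

theorem procDist_seq_gate (hlam : lam ∈ Set.Icc (0 : ℝ) 1) (j : Bool) (r : Set.Icc (0 : ℝ) 1) :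
    procDist tick lam (.seq (L.gate true) (L.source j r)) (.seq (L.gate true) (L.target j)) =
      lam * r := by
  have hd := isBisimMetric_procDist (tick := tick) hlam.1
  refine le_antisymm (procDist_seq_le hlam.1
    ((L.hasSteps_gate true).matched (L.hasSteps_gate true))
    (L.procDist_source_target hlam j r).le ?_) (L.le_procDist_seq_gate hlam j r)
  rintro _ _ ⟨rfl, rfl⟩
  rw [liftOp_pure_pure, liftOp_pure_pure,
    kantorovich_pure_pure hd.isBoundedPseudometric.mem_Icc,
    procDist_seq_act_nil hlam L.fresh_ne_tick, mul_zero]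
  exact mul_nonneg hlam.1 r.2.1

theorem kantorovich_seq (hlam : lam ∈ Set.Icc (0 : ℝ) 1) (j : Bool) (q r : Set.Icc (0 : ℝ) 1) :
    kantorovich (procDist tick lam)
      (liftOp .seq (mix q (L.gate true) .nil) (PMF.pure (L.source j r)))
      (liftOp .seq (PMF.pure (L.gate true)) (PMF.pure (L.target j))) =
      (1 - q) * (lam * r) + q := by
  have hd := isBisimMetric_procDist (tick := tick) hlam.1
  have hnil : procDist tick lam (.seq .nil (L.source j r)) (.seq (L.gate true) (L.target j)) = 1 :=
    hd.eq_one_of_can_right (a := L.common) (fun h => (can_seq_iff.1 h).elim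
        (fun h => not_can_nil tick _ h.2) fun h => not_can_nil tick _ h.1)
      (can_seq_iff.2 (Or.inl ⟨L.common_ne_tick, L.can_gate L.common_mem_offered true⟩))
  rw [kantorovich_liftOp_mix_pure hd.isBoundedPseudometric.mem_Icc,
    L.procDist_seq_gate hlam, hnil, mul_one]

theorem procDist_seq (hlam : lam ∈ Set.Icc (0 : ℝ) 1) (hj : true ≠ j)
    (q r : Set.Icc (0 : ℝ) 1) :
    procDist tick lam (.seq (L.source true q) (L.source j r))
      (.seq (L.target true) (L.target j)) =
      max (lam * ((1 - q) * (lam * r) + q)) (lam * r) := by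
  have hlt := L.label_ne_tick true
  refine le_antisymm (procDist_seq_le hlam.1
    ((L.hasSteps_source true q).matched (L.hasSteps_target true))
    ((L.procDist_source_target hlam j r).trans_le (le_max_right _ _)) ?_) (max_le ?_ ?_)
  · rintro _ _ ⟨rfl, rfl⟩
    rw [L.kantorovich_seq hlam]
    exact le_max_left _ _
  · rw [← L.kantorovich_seq hlam]
    refine (isBisimMetric_procDist hlam.1).mul_kantorovich_le hlam.2
      (Or.inl ⟨hlt, _, (L.hasSteps_source true q).step (L.label_mem_actions true), rfl⟩) ?_
    rintro π (⟨-, μ, hμ, rfl⟩ | ⟨-, h⟩)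
    · rw [(L.hasSteps_target true).eq_of_step hlt hμ]
    · exact (L.not_can_target_label hj ⟨π, h⟩).elim
  · exact L.le_procDist_of_step_label_iff hlam
      (fun _ => step_seq_right_iff (L.not_can_source_label hj.symm q) (L.can_source_true_tick q))
      (fun _ => step_seq_right_iff (L.not_can_target_label hj.symm) (L.can_source_true_tick _))

end TestActions

section DelayBound

variable {A : Type*} {lam e e' : ℝ}

theorem delayBound_mul (hlam : lam ≠ 0) (n : ℕ) (q r : ℝ) :
    delayBound lam n (lam * q) (lam * r) = lam * ((1 - q) * (lam ^ n * r) + q) := by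
  rw [delayBound, mul_div_cancel_left₀ q hlam]
  ring

theorem lt_delayBound (he : e < lam) (he' : 0 < e') (hlam : 0 < lam) (n : ℕ) :
    e < delayBound lam n e e' :=
  lt_add_of_pos_right e
    (mul_pos (mul_pos (pow_pos hlam n) (sub_pos.2 ((div_lt_one hlam).2 he))) he')

theorem lt_seqBound (hlam : lam ≤ 1) (he : e ∈ Set.Ioo 0 lam) : e < seqBound lam e e := by
  rw [seqBound, if_neg (he.2.trans_le hlam).ne]
  exact lt_max_of_lt_left (lt_delayBound he.2 he.1 (he.1.trans he.2) 1)

theorem lt_cspBound (hlam : lam ≤ 1) (he : e ∈ Set.Ioo 0 lam) (tick : A) (B : Set A) :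
    e < cspBound tick B lam e e := by
  have hne : ¬ (e = 1 ∨ e = 1) := or_self_iff.not.2 (he.2.trans_le hlam).ne
  have hlt (n : ℕ) := lt_delayBound he.2 he.1 (he.1.trans he.2) n
  rw [cspBound, syncBound, asyncBound, if_neg hne, if_neg hne]
  split_ifs
  exacts [hlt 0, lt_max_of_lt_left (hlt 2)]

end DelayBound

section TestPairs

variable {A : Type*} {tick : A} {lam : ℝ}

open Classical in
theorem exists_testActions_common_mem (hA : ∃ F : Finset A, tick ∉ F ∧ 4 ≤ F.card) (B : Set A) :
    ∃ L : TestActions tick, (B \ {tick}).Nonempty → L.common ∈ B := by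
  obtain ⟨F, hF, hcard⟩ := hA
  obtain ⟨a, hat, haB⟩ : ∃ a, tick ≠ a ∧ ((B \ {tick}).Nonempty → a ∈ B) := by
    by_cases hB : (B \ {tick}).Nonempty
    · obtain ⟨a, haB, hat⟩ := hB
      exact ⟨a, Ne.symm hat, fun _ => haB⟩
    · obtain ⟨a, ha⟩ := Finset.card_pos.1 (show 0 < F.card by omega)
      exact ⟨a, fun h => hF (h ▸ ha), fun h => (hB h).elim⟩
  have hcard' : 2 < (F.erase a).card := by
    have := F.pred_card_le_card_erase (a := a)
    omega
  obtain ⟨b, hb, c, hc, c', hc', hbc, hbc', hcc'⟩ := Finset.two_lt_card.1 hcard'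
  have hne {x : A} (hx : x ∈ F.erase a) : tick ≠ x ∧ a ≠ x :=
    ⟨fun h => hF (h ▸ Finset.mem_of_mem_erase hx), (Finset.ne_of_mem_erase hx).symm⟩
  refine ⟨⟨a, b, fun i => cond i c c', ?_⟩, haB⟩
  simp [hat, hne hb, hne hc, hne hc', hbc, hbc', hcc']

/-- Test pairs `s`, `t` of index `i` at distance `e`: a source and its target, or, for `e = 1`, two
processes of which only the first can perform `common` and `fresh`. -/
inductive IsTestPair (L : TestActions tick) (lam : ℝ) (i : Bool) : ℝ → Proc A → Proc A → Prop
  | source (q : Set.Icc (0 : ℝ) 1) (hq : lam * q ≠ 1) :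
      IsTestPair L lam i (lam * q) (L.source i q) (L.target i)
  | distinct : IsTestPair L lam i 1 (.alt (.act L.common .nil) (.act L.fresh .nil)) .nil

theorem exists_isTestPair (hlam : lam ∈ Set.Ioc (0 : ℝ) 1) (L : TestActions tick) (i : Bool)
    {e : ℝ} (he : e ∈ Set.Icc (0 : ℝ) lam ∪ {1}) :
    ∃ s t : Proc A, IsTestPair L lam i e s t := by
  by_cases h1 : e = 1
  · exact h1 ▸ ⟨_, _, .distinct⟩
  · obtain ⟨h0, hle⟩ := he.resolve_right h1
    have heq : lam * (e / lam) = e := mul_div_cancel₀ e hlam.1.ne'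
    have h := IsTestPair.source (L := L) (i := i)
      ⟨e / lam, div_nonneg h0 hlam.1.le, div_le_one_of_le₀ hle hlam.1.le⟩ (heq ▸ h1)
    exact ⟨_, _, heq ▸ h⟩

namespace IsTestPair

variable {L : TestActions tick} {i j : Bool} {e e' : ℝ} {s t s' t' : Proc A} {B : Set A}
  {f : Proc A → Proc A → Proc A}

theorem can_common (h : IsTestPair L lam i e s t) : Can (Step tick) s L.common := by
  rcases h with ⟨q, -⟩ | _
  · exact ⟨_, (L.hasSteps_source i q).step (L.common_mem_actions i)⟩
  · exact can_alt_iff.2 (Or.inl ⟨_, (hasSteps_act tick _ _).step rfl⟩)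

theorem not_can_fresh (h : IsTestPair L lam i e s t) : ¬ Can (Step tick) t L.fresh := by
  rcases h with ⟨q, -⟩ | _
  exacts [L.not_can_target_fresh i, not_can_nil tick _]

theorem can_fresh_distinct (L : TestActions tick) :
    Can (Step tick) (.alt (.act L.common .nil) (.act L.fresh .nil)) L.fresh :=
  can_alt_iff.2 (Or.inr ⟨_, (hasSteps_act tick _ _).step rfl⟩)

theorem le_procDist (hlam : lam ∈ Set.Icc (0 : ℝ) 1) (h : IsTestPair L lam i e s t)
    (h' : IsTestPair L lam j e' s' t') : e ≤ procDist tick lam s t' := by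
  have hd := isBisimMetric_procDist (tick := tick) hlam.1
  have hfresh := h'.not_can_fresh
  rcases h with ⟨q, -⟩ | _
  · rcases h' with ⟨r, -⟩ | _
    · exact L.le_procDist_source_target hlam i j q
    · rw [hd.eq_one_of_can_left ⟨_, (L.hasSteps_source i q).step (L.common_mem_actions i)⟩
        (not_can_nil tick _)]
      exact mul_le_one₀ hlam.2 q.2.1 q.2.2
  · exact (hd.eq_one_of_can_left (can_fresh_distinct L) hfresh).ge

theorem procDist_eq (hlam : lam ∈ Set.Icc (0 : ℝ) 1) (h : IsTestPair L lam i e s t) :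
    procDist tick lam s t = e := by
  rcases h with ⟨q, -⟩ | _
  · exact L.procDist_source_target hlam i q
  · exact (isBisimMetric_procDist hlam.1).eq_one_of_can_left (can_fresh_distinct L)
      (not_can_nil tick _)

theorem le_one (hlam : lam ∈ Set.Icc (0 : ℝ) 1) (h : IsTestPair L lam i e s t) : e ≤ 1 :=
  h.procDist_eq hlam ▸ (isBoundedPseudometric_procDist hlam.1).le_one s t

theorem procDist_alt (hlam : lam ∈ Set.Icc (0 : ℝ) 1) (hij : i ≠ j)
    (h : IsTestPair L lam i e s t) (h' : IsTestPair L lam j e' s' t') :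
    procDist tick lam (.alt s s') (.alt t t') = max e e' := by
  have hle := h.le_one hlam
  have hle' := h'.le_one hlam
  have hone (hs : Can (Step tick) s L.fresh ∨ Can (Step tick) s' L.fresh) :
      procDist tick lam (.alt s s') (.alt t t') = 1 :=
    (isBisimMetric_procDist hlam.1).eq_one_of_can_left (can_alt_iff.2 hs)
      fun ht => (can_alt_iff.1 ht).elim h.not_can_fresh h'.not_can_fresh
  rcases h with ⟨q, -⟩ | _
  · rcases h' with ⟨r, -⟩ | _
    · exact L.procDist_alt hlam hij q r
    · rw [hone (Or.inr (can_fresh_distinct L)), max_eq_right hle]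
  · rw [hone (Or.inl (can_fresh_distinct L)), max_eq_left hle']

theorem procDist_palt (hlam : lam ∈ Set.Icc (0 : ℝ) 1) (hij : i ≠ j) (p : Set.Ioo (0 : ℝ) 1)
    (h : IsTestPair L lam i e s t) (h' : IsTestPair L lam j e' s' t') :
    procDist tick lam (.palt p s s') (.palt p t t') = max e e' := by
  have hle := h.le_one hlam
  have hle' := h'.le_one hlam
  have hone (hs : Can (Step tick) s L.fresh ∨ Can (Step tick) s' L.fresh) :
      procDist tick lam (.palt p s s') (.palt p t t') = 1 :=
    (isBisimMetric_procDist hlam.1).eq_one_of_can_left (can_palt_iff.2 hs)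
      fun ht => (can_palt_iff.1 ht).elim h.not_can_fresh h'.not_can_fresh
  rcases h with ⟨q, -⟩ | _
  · rcases h' with ⟨r, -⟩ | _
    · exact L.procDist_palt hlam hij p q r
    · rw [hone (Or.inr (can_fresh_distinct L)), max_eq_right hle]
  · rw [hone (Or.inl (can_fresh_distinct L)), max_eq_left hle']

theorem procDist_seq (hlam : lam ∈ Set.Ioc (0 : ℝ) 1) (hj : true ≠ j)
    (h : IsTestPair L lam true e s t) (h' : IsTestPair L lam j e' s' t') :
    procDist tick lam (.seq s s') (.seq t t') = seqBound lam e e' := by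
  have hlam' := Set.Ioc_subset_Icc_self hlam
  have hone (hs : Can (Step tick) (.seq s s') L.fresh) :
      procDist tick lam (.seq s s') (.seq t t') = 1 :=
    (isBisimMetric_procDist hlam'.1).eq_one_of_can_left hs fun ht => (can_seq_iff.1 ht).elim
      (fun ht => h.not_can_fresh ht.2) fun ht => h'.not_can_fresh ht.2
  rw [seqBound]
  rcases h with ⟨q, hq⟩ | _
  · rw [if_neg hq]
    rcases h' with ⟨r, -⟩ | _
    · rw [L.procDist_seq hlam' hj, delayBound_mul hlam.1.ne', pow_one]
    · rw [hone (can_seq_iff.2 (Or.inr ⟨L.can_source_true_tick q, can_fresh_distinct L⟩)),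
        max_eq_right]
      rw [delayBound, mul_div_cancel_left₀ _ hlam.1.ne']
      linarith [hlam.2]
  · rw [if_pos rfl, hone (can_seq_iff.2 (Or.inl ⟨L.fresh_ne_tick, can_fresh_distinct L⟩))]

theorem procDist_sync (hlam : lam ∈ Set.Ioc (0 : ℝ) 1) (hf : ParallelOp tick B f)
    (hB : L.common ∈ B) (h : IsTestPair L lam i e s t) (h' : IsTestPair L lam j e' s' t') :
    procDist tick lam (f s s') (f t t') = syncBound lam e e' := by
  have hlam' := Set.Ioc_subset_Icc_self hlam
  have hct := L.common_ne_tick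
  have hs : Can (Step tick) (f s s') L.common :=
    (hf.can_sync_iff hct hB).2 ⟨h.can_common, h'.can_common⟩
  have hone (ht : ¬ (Can (Step tick) t L.common ∧ Can (Step tick) t' L.common)) :
      procDist tick lam (f s s') (f t t') = 1 :=
    (isBisimMetric_procDist hlam'.1).eq_one_of_can_left hs (mt (hf.can_sync_iff hct hB).1 ht)
  rw [syncBound]
  rcases h with ⟨q, hq⟩ | _
  · rcases h' with ⟨r, hr⟩ | _
    · rw [if_neg (not_or.2 ⟨hq, hr⟩), L.procDist_sync hlam' hf hB, delayBound_mul hlam.1.ne',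
        pow_zero, one_mul]
    · rw [if_pos (Or.inr rfl), hone fun h => not_can_nil tick _ h.2]
  · rw [if_pos (Or.inl rfl), hone fun h => not_can_nil tick _ h.1]

theorem procDist_async (hlam : lam ∈ Set.Ioc (0 : ℝ) 1) (hf : ParallelOp tick B f)
    (hB : B ⊆ {tick}) (hij : i ≠ j) (h : IsTestPair L lam i e s t)
    (h' : IsTestPair L lam j e' s' t') :
    procDist tick lam (f s s') (f t t') = asyncBound lam e e' := by
  have hlam' := Set.Ioc_subset_Icc_self hlam
  have hft := L.fresh_ne_tick
  have hfB : L.fresh ∉ B := fun h => hft (hB h)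
  have hone (hs : Can (Step tick) s L.fresh ∨ Can (Step tick) s' L.fresh) :
      procDist tick lam (f s s') (f t t') = 1 :=
    (isBisimMetric_procDist hlam'.1).eq_one_of_can_left ((hf.can_async_iff hft hfB).2 hs)
      fun ht => ((hf.can_async_iff hft hfB).1 ht).elim h.not_can_fresh h'.not_can_fresh
  rw [asyncBound]
  rcases h with ⟨q, hq⟩ | _
  · rcases h' with ⟨r, hr⟩ | _
    · simp only [if_neg (not_or.2 ⟨hq, hr⟩), L.procDist_async hlam' hf hB hij,
        delayBound_mul hlam.1.ne', sq, mul_assoc]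
    · rw [if_pos (Or.inr rfl), hone (Or.inr (can_fresh_distinct L))]
  · rw [if_pos (Or.inl rfl), hone (Or.inl (can_fresh_distinct L))]

theorem procDist_parallel (hlam : lam ∈ Set.Ioc (0 : ℝ) 1) (hf : ParallelOp tick B f)
    (hB : (B \ {tick}).Nonempty → L.common ∈ B) (hij : i ≠ j) (h : IsTestPair L lam i e s t)
    (h' : IsTestPair L lam j e' s' t') :
    procDist tick lam (f s s') (f t t') = cspBound tick B lam e e' := by
  rw [cspBound]
  split_ifs with hne
  · exact h.procDist_sync hlam hf (hB hne) h'
  · exact h.procDist_async hlam hf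
      (Set.sdiff_eq_empty.1 (Set.not_nonempty_iff_eq_empty.1 hne)) hij h'

end IsTestPair

theorem not_nonExtensive_of_lt {f : Proc A → Proc A → Proc A} {x x' y y' : Proc A} {e : ℝ}
    (hx : procDist tick lam x x' = e) (hy : procDist tick lam y y' = e)
    (hlt : e < procDist tick lam (f x y) (f x' y')) : ¬ NonExtensive tick lam f := fun h =>
  (h x y x' y').not_gt (by rwa [hx, hy, max_self])

theorem not_nonExtensive_seq (hlam : lam ∈ Set.Ioc (0 : ℝ) 1)
    (hA : ∃ F : Finset A, tick ∉ F ∧ 4 ≤ F.card) : ¬ NonExtensive tick lam .seq := by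
  have hhalf : lam / 2 ∈ Set.Ioo 0 lam := ⟨half_pos hlam.1, half_lt_self hlam.1⟩
  have hlam' := Set.Ioc_subset_Icc_self hlam
  obtain ⟨L, -⟩ := exists_testActions_common_mem hA ∅
  obtain ⟨x, x', hx⟩ := exists_isTestPair hlam L true (Or.inl (Set.Ioo_subset_Icc_self hhalf))
  obtain ⟨y, y', hy⟩ := exists_isTestPair hlam L false (Or.inl (Set.Ioo_subset_Icc_self hhalf))
  refine not_nonExtensive_of_lt (hx.procDist_eq hlam') (hy.procDist_eq hlam') ?_
  rw [hx.procDist_seq hlam Bool.noConfusion hy]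
  exact lt_seqBound hlam.2 hhalf

theorem ParallelOp.not_nonExtensive {B : Set A} {f : Proc A → Proc A → Proc A}
    (hlam : lam ∈ Set.Ioc (0 : ℝ) 1) (hA : ∃ F : Finset A, tick ∉ F ∧ 4 ≤ F.card)
    (hf : ParallelOp tick B f) : ¬ NonExtensive tick lam f := by
  have hhalf : lam / 2 ∈ Set.Ioo 0 lam := ⟨half_pos hlam.1, half_lt_self hlam.1⟩
  have hlam' := Set.Ioc_subset_Icc_self hlam
  obtain ⟨L, hL⟩ := exists_testActions_common_mem hA B
  obtain ⟨x, x', hx⟩ := exists_isTestPair hlam L true (Or.inl (Set.Ioo_subset_Icc_self hhalf))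
  obtain ⟨y, y', hy⟩ := exists_isTestPair hlam L false (Or.inl (Set.Ioo_subset_Icc_self hhalf))
  refine not_nonExtensive_of_lt (hx.procDist_eq hlam') (hy.procDist_eq hlam') ?_
  rw [hx.procDist_parallel hlam hf hL Bool.noConfusion hy]
  exact lt_cspBound hlam.2 hhalf tick B

theorem mainTheorem12_general (hlam : lam ∈ Set.Ioc (0 : ℝ) 1)
    (hA : ∃ F : Finset A, tick ∉ F ∧ 4 ≤ F.card) {I : Type*} {i j : I} (hij : i ≠ j) :
    (∀ ε : I → ℝ, (∀ k, ε k ∈ Set.Icc (0 : ℝ) lam ∪ {1}) → ∀ B : Set A,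
      ∃ s t : I → Proc A,
        (∀ k, procDist tick lam (s k) (t k) = ε k) ∧
        (∀ (a : A) (m : ℕ) (p : Weights m) (ι : Fin m → I),
          procDist tick lam (.pre a p fun k => s (ι k)) (.pre a p fun k => t (ι k)) =
            lam * ∑ k, p.w k * ε (ι k)) ∧
        procDist tick lam (.alt (s i) (s j)) (.alt (t i) (t j)) = max (ε i) (ε j) ∧
        (∀ p, procDist tick lam (.palt p (s i) (s j)) (.palt p (t i) (t j)) =
          max (ε i) (ε j)) ∧
        procDist tick lam (.seq (s i) (s j)) (.seq (t i) (t j)) = seqBound lam (ε i) (ε j) ∧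
        procDist tick lam (.sync (s i) (s j)) (.sync (t i) (t j)) =
          syncBound lam (ε i) (ε j) ∧
        procDist tick lam (.async (s i) (s j)) (.async (t i) (t j)) =
          asyncBound lam (ε i) (ε j) ∧
        procDist tick lam (.csp B (s i) (s j)) (.csp B (t i) (t j)) =
          cspBound tick B lam (ε i) (ε j) ∧
        (∀ p, procDist tick lam (.pasync p (s i) (s j)) (.pasync p (t i) (t j)) =
          asyncBound lam (ε i) (ε j))) ∧
    ¬ NonExtensive tick lam .seq ∧
    ¬ NonExtensive tick lam .sync ∧
    ¬ NonExtensive tick lam .async ∧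
    (∀ B, ¬ NonExtensive tick lam (.csp B)) ∧
    (∀ p, ¬ NonExtensive tick lam (.pasync p)) := by
  refine ⟨fun ε hε B => ?_, not_nonExtensive_seq hlam hA,
    (parallelOp_sync tick).not_nonExtensive hlam hA,
    (parallelOp_async tick).not_nonExtensive hlam hA,
    fun B => (parallelOp_csp tick B).not_nonExtensive hlam hA,
    fun p => (parallelOp_pasync tick p).not_nonExtensive hlam hA⟩
  classical
  have hlam' := Set.Ioc_subset_Icc_self hlam
  obtain ⟨L, hL⟩ := exists_testActions_common_mem hA B
  choose s t h using fun k => exists_isTestPair hlam L (decide (k = i)) (hε k)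
  have hi : IsTestPair L lam true (ε i) (s i) (t i) := by simpa using h i
  have hj : IsTestPair L lam false (ε j) (s j) (t j) := by simpa [hij.symm] using h j
  have hne : true ≠ false := Bool.noConfusion
  refine ⟨s, t, fun k => (h k).procDist_eq hlam', fun a m p ι => le_antisymm ?_ ?_,
    hi.procDist_alt hlam' hne hj, fun p => hi.procDist_palt hlam' hne p hj,
    hi.procDist_seq hlam hne hj,
    hi.procDist_sync hlam (parallelOp_sync tick) (Set.mem_univ _) hj,
    hi.procDist_async hlam (parallelOp_async tick) (Set.empty_subset _) hne hj,
    hi.procDist_parallel hlam (parallelOp_csp tick B) hL hne hj,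
    fun p => hi.procDist_async hlam (parallelOp_pasync tick p) (Set.empty_subset _) hne hj⟩
  · simpa only [(h _).procDist_eq hlam'] using
      procDist_pre_le (tick := tick) hlam'.1 a p (fun k => s (ι k)) (fun k => t (ι k))
  · exact le_procDist_pre hlam' a p fun k l => (h (ι k)).le_procDist hlam' (h (ι l))

end TestPairs

end

theorem mainTheorem12 {A : Type*} (tick : A) (lam : ℝ) (hlam : lam ∈ Set.Ioc (0 : ℝ) 1)
    (n : ℕ) (hA : ∃ F : Finset A, tick ∉ F ∧ n + 4 ≤ F.card) :
    (∀ ε : Fin (n + 2) → ℝ, (∀ i, ε i ∈ Set.Icc (0 : ℝ) lam ∪ {1}) → ∀ B : Set A,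
      ∃ s t : Fin (n + 2) → Proc A,
        (∀ i, procDist tick lam (s i) (t i) = ε i) ∧
        (∀ (a : A) (m : ℕ) (p : Weights m) (ι : Fin m → Fin (n + 2)),
          procDist tick lam (.pre a p fun k => s (ι k)) (.pre a p fun k => t (ι k)) =
            lam * ∑ k, p.w k * ε (ι k)) ∧
        procDist tick lam (.alt (s 0) (s 1)) (.alt (t 0) (t 1)) = max (ε 0) (ε 1) ∧
        (∀ p, procDist tick lam (.palt p (s 0) (s 1)) (.palt p (t 0) (t 1)) =
          max (ε 0) (ε 1)) ∧
        procDist tick lam (.seq (s 0) (s 1)) (.seq (t 0) (t 1)) = seqBound lam (ε 0) (ε 1) ∧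
        procDist tick lam (.sync (s 0) (s 1)) (.sync (t 0) (t 1)) =
          syncBound lam (ε 0) (ε 1) ∧
        procDist tick lam (.async (s 0) (s 1)) (.async (t 0) (t 1)) =
          asyncBound lam (ε 0) (ε 1) ∧
        procDist tick lam (.csp B (s 0) (s 1)) (.csp B (t 0) (t 1)) =
          cspBound tick B lam (ε 0) (ε 1) ∧
        (∀ p, procDist tick lam (.pasync p (s 0) (s 1)) (.pasync p (t 0) (t 1)) =
          asyncBound lam (ε 0) (ε 1))) ∧
    ¬ NonExtensive tick lam .seq ∧
    ¬ NonExtensive tick lam .sync ∧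
    ¬ NonExtensive tick lam .async ∧
    (∀ B, ¬ NonExtensive tick lam (.csp B)) ∧
    (∀ p, ¬ NonExtensive tick lam (.pasync p)) := by
  obtain ⟨F, hF, hcard⟩ := hA
  exact mainTheorem12_general hlam ⟨F, hF, by omega⟩ Fin.zero_ne_one
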